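/- Let $\Gamma\subset\mathbb C$ be a Jordan curve (equivalently, a Jordan curve in the Riemann sphere that does not contain $\infty$). Let $\Omega^+$ be the bounded component of $\mathbb C\setminus\Gamma$ and let $\Omega^-\ni\infty$ be the other component of the complement of $\Gamma$ in the sphere. For an open subset $\Omega$ of the sphere let $\mathcal D_{\mathrm{harm}}(\Omega)$ be the space of complex-valued harmonic functions $H$ on $\Omega$ with $$\|H\|_{\mathcal D_{\mathrm{harm}}(\Omega)}^2=\iint_\Omega\left(|\partial H|^2+|\overline\partial H|^2\right)dA<\infty,$$ and let $\mathcal D(\Omega)$ be the subspace of holomorphic functions, with the same seminorm; harmonicity or holomorphy at $\infty$ means that of $H(1/z)$ at $0$. Let $\mathcal H_+(\Gamma)$ be the set of functions $h$ on $\Gamma$ (up to sets of harmonic measure zero with respect to $\Omega^+$) that are boundary values of some $H\in\mathcal D_{\mathrm{harm}}(\Omega^+)$: for some $p\in\Omega^+$ and for almost every $q\in\Gamma$ with respect to the harmonic measure of $\Omega^+$ at $p$, $h(q)$ is the limit of $H$ at $q$ along the ray from $p$ to $q$ that is orthogonal to the level curves of Green's function of $\Omega^+$ with singularity at $p$. Such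 an $H$ is determined by $h$; it is denoted by $h_{\Omega^+}$, and $\|h\|_{\mathcal H_+(\Gamma)}=\|h_{\Omega^+}\|_{\mathcal D_{\mathrm{harm}}(\Omega^+)}$. For $h\in\mathcal H_+(\Gamma)$ put $$J(\Gamma)h(z)=h_{\Omega^+}(z)\,\chi_{\Omega^+}(z)+\frac1\pi\iint_{\Omega^+}\frac{\overline\partial h_{\Omega^+}(\zeta)}{\zeta-z}\,dA(\zeta),\qquad z\in\mathbb C\setminus\Gamma,$$ and $J(\Gamma)h(\infty)=0$. Then $J(\Gamma)h$ is holomorphic on $\Omega^+\sqcup\Omega^-$ for every $h\in\mathcal H_+(\Gamma)$. Furthermore, the operators $$P(\Omega^+):\mathcal H_+(\Gamma)\to\mathcal D(\Omega^+),\quad h\mapsto J(\Gamma)h|_{\Omega^+},\qquad P(\Omega^-):\mathcal H_+(\Gamma)\to\mathcal D(\Omega^-),\quad h\mapsto -J(\Gamma)h|_{\Omega^-},$$ are well defined (their values lie in $\mathcal D(\Omega^\pm)$) and bounded: there are constants $C_\pm$, depending only on $\Gamma$, such that $$\|P(\Omega^\pm)h\|_{\mathcal D(\Omega^\pm)}\le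 C_\pm\,\|h\|_{\mathcal H_+(\Gamma)}\qquad\text{for all }h\in\mathcal H_+(\Gamma).$$ -/

import Mathlib

open scoped OnePoint

noncomputable section

namespace JumpOperator

/-! The Riemann sphere is `OnePoint ℂ`. A function "on" an open set `Ω` of the sphere is a function
on the whole sphere of which only the values on `Ω` are ever used. -/

/-- The coordinate `w ↦ 1 / w` of the sphere around `∞`, with `0 ↦ ∞`. -/
def invChart (w : ℂ) : OnePoint ℂ := if w = 0 then ∞ else ((w⁻¹ : ℂ) : OnePoint ℂ)

/-- Harmonicity of a complex-valued function on an open subset of the sphere; at `∞` it means that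
`w ↦ f (1 / w)` is harmonic near `0`. -/
def IsHarmonicOn (Ω : Set (OnePoint ℂ)) (f : OnePoint ℂ → ℂ) : Prop :=
  (∀ z : ℂ, (z : OnePoint ℂ) ∈ Ω → InnerProductSpace.HarmonicAt (fun x : ℂ => f x) z) ∧
    (∞ ∈ Ω → InnerProductSpace.HarmonicAt (fun w : ℂ => f (invChart w)) 0)

/-- Holomorphy of a function on an open subset of the sphere; at `∞` it means that
`w ↦ f (1 / w)` is holomorphic near `0`. -/
def IsHolomorphicOn (Ω : Set (OnePoint ℂ)) (f : OnePoint ℂ → ℂ) : Prop :=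
  (∀ z : ℂ, (z : OnePoint ℂ) ∈ Ω → AnalyticAt ℂ (fun x : ℂ => f x) z) ∧
    (∞ ∈ Ω → AnalyticAt ℂ (fun w : ℂ => f (invChart w)) 0)

/-- The Wirtinger derivative `∂ = (∂ₓ - i ∂ᵧ) / 2`. -/
def wirtinger (f : ℂ → ℂ) (z : ℂ) : ℂ :=
  (fderiv ℝ f z 1 - Complex.I * fderiv ℝ f z Complex.I) / 2

/-- The conjugate Wirtinger derivative `∂̄ = (∂ₓ + i ∂ᵧ) / 2`. -/
def wirtingerBar (f : ℂ → ℂ) (z : ℂ) : ℂ :=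
  (fderiv ℝ f z 1 + Complex.I * fderiv ℝ f z Complex.I) / 2

/-- The Dirichlet energy `∬_Ω (|∂f|² + |∂̄f|²) dA`, possibly infinite; the point `∞` is negligible. -/
def dirichletEnergy (Ω : Set (OnePoint ℂ)) (f : OnePoint ℂ → ℂ) : ENNReal :=
  ∫⁻ z in {z : ℂ | (z : OnePoint ℂ) ∈ Ω},
    (‖wirtinger (fun x : ℂ => f x) z‖ₑ ^ 2 + ‖wirtingerBar (fun x : ℂ => f x) z‖ₑ ^ 2)

/-- The harmonic Dirichlet space `𝒟_harm(Ω)`. -/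
def DirichletHarm (Ω : Set (OnePoint ℂ)) : Set (OnePoint ℂ → ℂ) :=
  {f | IsHarmonicOn Ω f ∧ dirichletEnergy Ω f < ⊤}

/-- The holomorphic Dirichlet space `𝒟(Ω)`. -/
def DirichletHol (Ω : Set (OnePoint ℂ)) : Set (OnePoint ℂ → ℂ) :=
  {f | f ∈ DirichletHarm Ω ∧ IsHolomorphicOn Ω f}

/-- The Dirichlet seminorm, on `𝒟_harm(Ω)` and, by restriction, on `𝒟(Ω)`. -/
def dirichletSeminorm (Ω : Set (OnePoint ℂ)) (f : OnePoint ℂ → ℂ) : ℝ :=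
  Real.sqrt (dirichletEnergy Ω f).toReal

/-- `Γ` is a Jordan curve in the plane, that is, a Jordan curve in the sphere that avoids `∞`. -/
def IsJordanCurve (Γ : Set ℂ) : Prop :=
  ∃ c : Circle → ℂ, Continuous c ∧ Function.Injective c ∧ Set.range c = Γ

/-- The bounded component of the complement of a Jordan curve `Γ`, as a subset of the plane. -/
def inside (Γ : Set ℂ) : Set ℂ :=
  {z | z ∈ Γᶜ ∧ Bornology.IsBounded (connectedComponentIn Γᶜ z)}

/-- The component `Ω⁺` of the complement of `Γ` in the sphere, which does not contain `∞`. -/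
def OmegaPlus (Γ : Set ℂ) : Set (OnePoint ℂ) :=
  (fun z : ℂ => (z : OnePoint ℂ)) '' inside Γ

/-- The component `Ω⁻` of the complement of `Γ` in the sphere, which contains `∞`. -/
def OmegaMinus (Γ : Set ℂ) : Set (OnePoint ℂ) :=
  insert ∞ ((fun z : ℂ => (z : OnePoint ℂ)) ''
    {z | z ∈ Γᶜ ∧ ¬ Bornology.IsBounded (connectedComponentIn Γᶜ z)})

/-- `g` is Green's function of the bounded domain `Ω` with singularity at `p`, with the sign
convention `g ≤ 0`: it is harmonic off `p`, behaves like `log |z - p|` at `p`, and vanishes on the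
boundary. -/
def IsGreenFunction (Ω : Set ℂ) (p : ℂ) (g : ℂ → ℝ) : Prop :=
  InnerProductSpace.HarmonicOnNhd g (Ω \ {p}) ∧
    (∃ v : ℂ → ℝ, InnerProductSpace.HarmonicAt v p ∧
      ∀ᶠ z in nhdsWithin p {p}ᶜ, g z = Real.log ‖z - p‖ + v z) ∧
    ∀ q ∈ frontier Ω, Filter.Tendsto g (nhdsWithin q Ω) (nhds 0)

/-- `γ` on `[0, 1]` is a parametrization of the ray in `Ω` from `p` to the boundary point `q` that is
orthogonal to the level curves of `g`: its velocity is everywhere a positive multiple of the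
gradient of `g`. -/
def IsOrthogonalRay (Ω : Set ℂ) (g : ℂ → ℝ) (p q : ℂ) (γ : ℝ → ℂ) : Prop :=
  ContinuousOn γ (Set.Icc 0 1) ∧ γ 0 = p ∧ γ 1 = q ∧
    ∀ t ∈ Set.Ioo (0 : ℝ) 1, γ t ∈ Ω \ {p} ∧
      ∃ c : ℝ, 0 < c ∧ HasDerivAt γ (c • gradient g (γ t)) t

/-- `ν` is the harmonic measure of the bounded domain `Ω` with respect to the point `p`: the
probability measure on the boundary that represents the value at `p` of every function which is
harmonic in `Ω` and continuous on the closure. -/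
def IsHarmonicMeasure (Ω : Set ℂ) (p : ℂ) (ν : MeasureTheory.Measure ℂ) : Prop :=
  MeasureTheory.IsProbabilityMeasure ν ∧ ν (frontier Ω)ᶜ = 0 ∧
    ∀ u : ℂ → ℝ, InnerProductSpace.HarmonicContOnCl u Ω → u p = ∫ z, u z ∂ν

/-- `h` is the boundary function of `H` from inside `Γ` in the sense of Osborn: at almost every `q`
in `Γ`, with respect to harmonic measure at some point `p` inside, `h q` is the limit of `H` along
the orthogonal ray of Green's function that starts at `p` and ends at `q`. -/
def HasBoundaryValues (Γ : Set ℂ) (H : OnePoint ℂ → ℂ) (h : Γ → ℂ) : Prop :=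
  ∃ p ∈ inside Γ, ∃ (g : ℂ → ℝ) (ν : MeasureTheory.Measure ℂ),
    IsGreenFunction (inside Γ) p g ∧ IsHarmonicMeasure (inside Γ) p ν ∧
      ∀ᵐ q ∂ν, ∀ hq : q ∈ Γ, ∃ γ : ℝ → ℂ, IsOrthogonalRay (inside Γ) g p q γ ∧
        Filter.Tendsto (fun t => H (γ t)) (nhdsWithin 1 (Set.Iio 1)) (nhds (h ⟨q, hq⟩))

/-- The space `ℋ₊(Γ)` of boundary functions of elements of `𝒟_harm(Ω⁺)`; its elements matter only up
to equality almost everywhere for harmonic measure. -/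
def HPlus (Γ : Set ℂ) : Set (Γ → ℂ) :=
  {h | ∃ H ∈ DirichletHarm (OmegaPlus Γ), HasBoundaryValues Γ H h}

open Classical in
/-- The extension `h_{Ω⁺}` of `h ∈ ℋ₊(Γ)` to an element of `𝒟_harm(Ω⁺)`. (The values on `Ω⁺`, the
only ones used, are determined by `h`.) -/
def extension (Γ : Set ℂ) (h : Γ → ℂ) : OnePoint ℂ → ℂ :=
  if hh : ∃ H ∈ DirichletHarm (OmegaPlus Γ), HasBoundaryValues Γ H h then hh.choose else 0

/-- The seminorm of `ℋ₊(Γ)`, the Dirichlet seminorm of the extension to `Ω⁺`. -/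
def hPlusSeminorm (Γ : Set ℂ) (h : Γ → ℂ) : ℝ :=
  dirichletSeminorm (OmegaPlus Γ) (extension Γ h)

/-- The jump operator
`J(Γ)h(z) = h_{Ω⁺}(z) χ_{Ω⁺}(z) + (1/π) ∬_{Ω⁺} ∂̄h_{Ω⁺}(ζ) / (ζ - z) dA(ζ)`
for `z` in the plane off `Γ`, extended by its limit `0` to `∞`. -/
def jump (Γ : Set ℂ) (h : Γ → ℂ) : OnePoint ℂ → ℂ
  | ∞ => 0
  | (z : ℂ) =>
      (inside Γ).indicator (fun x : ℂ => extension Γ h x) z +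
        (1 / Real.pi : ℂ) *
          ∫ ζ in inside Γ, wirtingerBar (fun x : ℂ => extension Γ h x) ζ / (ζ - z)

/-- `P(Ω⁺)h = J(Γ)h` on `Ω⁺`. -/
def projPlus (Γ : Set ℂ) (h : Γ → ℂ) : OnePoint ℂ → ℂ := (OmegaPlus Γ).indicator (jump Γ h)

/-- `P(Ω⁻)h = -J(Γ)h` on `Ω⁻`. -/
def projMinus (Γ : Set ℂ) (h : Γ → ℂ) : OnePoint ℂ → ℂ := (OmegaMinus Γ).indicator (-jump Γ h)

end JumpOperator

end

namespace JumpOperator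

open MeasureTheory Set Filter Topology Metric

/-! ### Wirtinger calculus -/

/-! Let `f` be `∂̄h_{Ω⁺}` extended by zero (`density`) and `C` the Cauchy transform, so that `J(Γ)h
= h_{Ω⁺} χ_{Ω⁺} + Cf`. Finite energy puts `f` in `L²`, and in `L¹` because `Ω⁺` is bounded.

Holomorphy: `∂̄Cf = -f` on `Ω⁺`, which cancels `∂̄h_{Ω⁺}`. Outside, `f` vanishes and the integral
can be differentiated under the sign. At `∞`, `Cf = O(1/|z|)` makes the singularity removable.

Boundedness: everything rests on the contraction `∬ |∂Cf|² ≤ ∬ |f|²` off `Γ`, the `L²` bound for the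
Beurling transform `f ↦ ∂Cf` up to sign, proved without Fourier analysis. A test function has equal
`∂` and `∂̄` energies, since `|∂u|² - |∂̄u|²` is the Jacobian, which integrates to zero
(`integral_norm_wirtinger_sq`). For a test function `f`, the function `u = Cf` satisfies `∂̄u = -f`
and decays like `1/|z|`, so cutting it off at radius `R` costs only `O(1/R²)`, and Fatou gives the
inequality (`lintegral_wirtinger_sq_le`). The actual density is merely smooth on `Ω⁺`. It is
approximated by test functions that agree with it near each given point from some index on. The rest
of the transform is then holomorphic near that point with derivative tending to zero, and Fatou
applies again (`lintegral_wirtinger_cauchyTransform_sq_le_of_isOpen`).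

Hence the energy of `P(Ω⁻)h` is at most that of `h_{Ω⁺}`, and the energy of `P(Ω⁺)h` at most twice
it. -/

theorem wirtinger_congr {f g : ℂ → ℂ} {z : ℂ} (h : f =ᶠ[𝓝 z] g) :
    wirtinger f z = wirtinger g z := by
  simp only [wirtinger, h.fderiv_eq]

theorem wirtingerBar_congr {f g : ℂ → ℂ} {z : ℂ} (h : f =ᶠ[𝓝 z] g) :
    wirtingerBar f z = wirtingerBar g z := by
  simp only [wirtingerBar, h.fderiv_eq]

theorem wirtinger_add {f g : ℂ → ℂ} {z : ℂ} (hf : DifferentiableAt ℝ f z)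
    (hg : DifferentiableAt ℝ g z) :
    wirtinger (fun x => f x + g x) z = wirtinger f z + wirtinger g z := by
  simp only [wirtinger, fderiv_fun_add hf hg, add_apply]
  ring

theorem wirtingerBar_add {f g : ℂ → ℂ} {z : ℂ} (hf : DifferentiableAt ℝ f z)
    (hg : DifferentiableAt ℝ g z) :
    wirtingerBar (fun x => f x + g x) z = wirtingerBar f z + wirtingerBar g z := by
  simp only [wirtingerBar, fderiv_fun_add hf hg, add_apply]
  ring

theorem wirtinger_neg (f : ℂ → ℂ) (z : ℂ) : wirtinger (fun x => -f x) z = -wirtinger f z := by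
  simp only [wirtinger, fderiv_fun_neg, neg_apply]
  ring

theorem wirtingerBar_mul {f g : ℂ → ℂ} {z : ℂ} (hf : DifferentiableAt ℝ f z)
    (hg : DifferentiableAt ℝ g z) :
    wirtingerBar (fun x => f x * g x) z = f z * wirtingerBar g z + g z * wirtingerBar f z := by
  simp only [wirtingerBar, fderiv_fun_mul hf hg, add_apply,
    smul_apply, smul_eq_mul]
  ring

theorem wirtinger_of_hasDerivAt {f : ℂ → ℂ} {f' z : ℂ} (h : HasDerivAt f f' z) :
    wirtinger f z = f' := by
  have h1 := (h.hasFDerivAt.restrictScalars ℝ).fderiv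
  simp only [wirtinger, h1, ContinuousLinearMap.coe_restrictScalars',
    ContinuousLinearMap.toSpanSingleton_apply, smul_eq_mul]
  linear_combination (-f' / 2) * Complex.I_sq

theorem wirtingerBar_of_hasDerivAt {f : ℂ → ℂ} {f' z : ℂ} (h : HasDerivAt f f' z) :
    wirtingerBar f z = 0 := by
  have h1 := (h.hasFDerivAt.restrictScalars ℝ).fderiv
  simp only [wirtingerBar, h1, ContinuousLinearMap.coe_restrictScalars',
    ContinuousLinearMap.toSpanSingleton_apply, smul_eq_mul]
  linear_combination (f' / 2) * Complex.I_sq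

theorem differentiableAt_of_wirtingerBar_eq_zero {f : ℂ → ℂ} {z : ℂ}
    (hf : DifferentiableAt ℝ f z) (h : wirtingerBar f z = 0) : DifferentiableAt ℂ f z := by
  refine differentiableAt_complex_iff_differentiableAt_real.2 ⟨hf, ?_⟩
  rw [wirtingerBar] at h
  rw [smul_eq_mul]
  linear_combination (-2 * Complex.I) * h + fderiv ℝ f z Complex.I * Complex.I_sq

theorem norm_wirtingerBar_le (f : ℂ → ℂ) (z : ℂ) : ‖wirtingerBar f z‖ ≤ ‖fderiv ℝ f z‖ := by
  have h1 : ‖fderiv ℝ f z 1‖ ≤ ‖fderiv ℝ f z‖ := by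
    simpa using (fderiv ℝ f z).le_opNorm 1
  have h2 : ‖fderiv ℝ f z Complex.I‖ ≤ ‖fderiv ℝ f z‖ := by
    simpa using (fderiv ℝ f z).le_opNorm Complex.I
  have h3 := norm_add_le (fderiv ℝ f z 1) (Complex.I * fderiv ℝ f z Complex.I)
  rw [norm_mul, Complex.norm_I, one_mul] at h3
  rw [wirtingerBar, norm_div, Complex.norm_ofNat]
  linarith

theorem continuous_wirtinger {f : ℂ → ℂ} (hf : ContDiff ℝ 1 f) : Continuous (wirtinger f) := by
  have := hf.continuous_fderiv one_ne_zero
  unfold wirtinger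
  fun_prop

theorem continuous_wirtingerBar {f : ℂ → ℂ} (hf : ContDiff ℝ 1 f) :
    Continuous (wirtingerBar f) := by
  have := hf.continuous_fderiv one_ne_zero
  unfold wirtingerBar
  fun_prop

theorem hasCompactSupport_wirtinger {f : ℂ → ℂ} (hf : HasCompactSupport f) :
    HasCompactSupport (wirtinger f) :=
  (hf.fderiv ℝ).mono fun z hz => by
    contrapose! hz
    simp [wirtinger, Function.notMem_support.1 hz]

theorem hasCompactSupport_wirtingerBar {f : ℂ → ℂ} (hf : HasCompactSupport f) :
    HasCompactSupport (wirtingerBar f) :=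
  (hf.fderiv ℝ).mono fun z hz => by
    contrapose! hz
    simp [wirtingerBar, Function.notMem_support.1 hz]

/-! ### The operators `∂` and `∂̄` have the same energy on test functions -/

/-- Integration by parts turns either side into minus the integral of the mixed second derivative
times `star f`, which is symmetric in `v` and `w`. -/
theorem integral_fderiv_mul_star_fderiv {f : ℂ → ℂ} (hf : ContDiff ℝ 2 f)
    (hc : HasCompactSupport f) (v w : ℂ) :
    ∫ z, fderiv ℝ f z v * star (fderiv ℝ f z w) =
      ∫ z, fderiv ℝ f z w * star (fderiv ℝ f z v) := by
  have hdf : ContDiff ℝ 1 (fderiv ℝ f) := hf.fderiv_right (by norm_num)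
  have hg : ContDiff ℝ 2 (fun z => star (f z)) := Complex.conjCLE.contDiff.comp hf
  have hgc : HasCompactSupport (fun z => star (f z)) := hc.comp_left (g := star) (by simp)
  have hd : Differentiable ℝ f := hf.differentiable two_ne_zero
  have hstar (z a : ℂ) : fderiv ℝ (fun z => star (f z)) z a = star (fderiv ℝ f z a) := by
    have := ((Complex.conjCLE : ℂ ≃L[ℝ] ℂ).hasFDerivAt.comp z (hd z).hasFDerivAt).fderiv
    exact DFunLike.congr_fun this a
  have hdv (a : ℂ) : ContDiff ℝ 1 (fun z => fderiv ℝ f z a) := hdf.clm_apply contDiff_const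
  have hdc (a : ℂ) : HasCompactSupport (fun z => fderiv ℝ f z a) := hc.fderiv_apply ℝ a
  have key (a b : ℂ) : ∫ z, fderiv ℝ f z a * star (fderiv ℝ f z b) =
      -∫ z, fderiv ℝ (fderiv ℝ f) z b a * star (f z) := by
    have h := integral_mul_fderiv_eq_neg_fderiv_mul_of_integrable (μ := (volume : Measure ℂ))
      (f := fun z => fderiv ℝ f z a) (g := fun z => star (f z)) (v := b) ?_ ?_ ?_
      (fun x _ => (hdv a).differentiable one_ne_zero x)
      (fun x _ => hg.differentiable two_ne_zero x)
    · simp only [hstar] at h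
      rw [h]
      congr 2
      ext z
      rw [fderiv_clm_apply (hdf.differentiable one_ne_zero z) (by fun_prop)]
      simp
    · refine Continuous.integrable_of_hasCompactSupport ?_ (hgc.mul_left)
      exact (((hdv a).continuous_fderiv one_ne_zero).clm_apply continuous_const).mul hg.continuous
    · refine Continuous.integrable_of_hasCompactSupport ?_ (HasCompactSupport.mul_right (hdc a))
      exact (hdv a).continuous.mul
        ((hg.continuous_fderiv two_ne_zero).clm_apply continuous_const)
    · exact ((hdv a).continuous.mul hg.continuous).integrable_of_hasCompactSupport hgc.mul_left
  rw [key, key]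
  congr 2
  ext z
  have hs : IsSymmSndFDerivAt ℝ f z := hf.contDiffAt.isSymmSndFDerivAt (by simp)
  rw [hs.eq]

theorem integral_norm_wirtinger_sq {f : ℂ → ℂ} (hf : ContDiff ℝ 2 f)
    (hc : HasCompactSupport f) :
    ∫ z, ‖wirtinger f z‖ ^ 2 = ∫ z, ‖wirtingerBar f z‖ ^ 2 := by
  have hf1 : ContDiff ℝ 1 f := hf.of_le (by norm_num)
  have hcd (a : ℂ) : Continuous (fun z => fderiv ℝ f z a) :=
    (hf1.continuous_fderiv one_ne_zero).clm_apply continuous_const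
  have hint (v w : ℂ) : Integrable fun z => fderiv ℝ f z v * star (fderiv ℝ f z w) :=
    ((hcd v).mul (continuous_star.comp (hcd w))).integrable_of_hasCompactSupport
      (HasCompactSupport.mul_right (hc.fderiv_apply ℝ v))
  have hi1 : Integrable fun z => ((‖wirtinger f z‖ ^ 2 : ℝ) : ℂ) := by
    refine Continuous.integrable_of_hasCompactSupport ?_
      ((hasCompactSupport_wirtinger hc).comp_left (g := fun w : ℂ => ((‖w‖ ^ 2 : ℝ) : ℂ)) (by simp))
    have := continuous_wirtinger hf1
    fun_prop
  have hi2 : Integrable fun z => ((‖wirtingerBar f z‖ ^ 2 : ℝ) : ℂ) := by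
    refine Continuous.integrable_of_hasCompactSupport ?_
      ((hasCompactSupport_wirtingerBar hc).comp_left
        (g := fun w : ℂ => ((‖w‖ ^ 2 : ℝ) : ℂ)) (by simp))
    have := continuous_wirtingerBar hf1
    fun_prop
  -- The difference of the two densities is the Jacobian of `f`.
  have hsub : ∫ z, (((‖wirtinger f z‖ ^ 2 : ℝ) : ℂ) - ((‖wirtingerBar f z‖ ^ 2 : ℝ) : ℂ)) =
      ∫ z, Complex.I / 2 * (fderiv ℝ f z 1 * star (fderiv ℝ f z Complex.I) -
        fderiv ℝ f z Complex.I * star (fderiv ℝ f z 1)) := by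
    congr 1
    ext z
    simp only [Complex.ofReal_pow, ← Complex.mul_conj', wirtinger, wirtingerBar, map_div₀, map_sub,
      map_add, map_mul, Complex.conj_I, Complex.conj_ofNat, Complex.star_def]
    ring
  rw [integral_sub hi1 hi2, integral_const_mul, integral_sub (hint _ _) (hint _ _),
    integral_fderiv_mul_star_fderiv hf hc, sub_self, mul_zero, sub_eq_zero] at hsub
  rwa [integral_complex_ofReal, integral_complex_ofReal, Complex.ofReal_inj] at hsub

theorem lintegral_enorm_sq_eq_ofReal {f : ℂ → ℂ} (hf : Continuous f) (hc : HasCompactSupport f) :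
    ∫⁻ z, ‖f z‖ₑ ^ 2 = ENNReal.ofReal (∫ z, ‖f z‖ ^ 2) := by
  rw [ofReal_integral_eq_lintegral_ofReal]
  · congr 1
    ext z
    rw [ENNReal.ofReal_pow (norm_nonneg _), ofReal_norm]
  · exact (by fun_prop : Continuous fun z => ‖f z‖ ^ 2).integrable_of_hasCompactSupport
      (hc.comp_left (g := fun w : ℂ => ‖w‖ ^ 2) (by simp))
  · exact ae_of_all _ fun z => by positivity

theorem lintegral_wirtinger_sq {f : ℂ → ℂ} (hf : ContDiff ℝ 2 f) (hc : HasCompactSupport f) :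
    ∫⁻ z, ‖wirtinger f z‖ₑ ^ 2 = ∫⁻ z, ‖wirtingerBar f z‖ₑ ^ 2 := by
  have hf1 : ContDiff ℝ 1 f := hf.of_le (by norm_num)
  rw [lintegral_enorm_sq_eq_ofReal (continuous_wirtinger hf1) (hasCompactSupport_wirtinger hc),
    lintegral_enorm_sq_eq_ofReal (continuous_wirtingerBar hf1) (hasCompactSupport_wirtingerBar hc),
    integral_norm_wirtinger_sq hf hc]

/-! ### The Cauchy–Pompeiu formula -/

/-- In polar coordinates the area factor `r` cancels the singularity: `r ∂̄f / w = (∂_r f + (i/r)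
∂_θ f) / 2`. The radial term integrates to `-f 0` for each angle, and the angular term to zero by
periodicity. -/
theorem integral_wirtingerBar_div {f : ℂ → ℂ} (hf : ContDiff ℝ 1 f) (hc : HasCompactSupport f) :
    ∫ w, wirtingerBar f w / w = -Real.pi * f 0 := by
  set e : ℝ → ℂ := fun θ => Real.cos θ + Real.sin θ * Complex.I with he
  have hde (θ : ℝ) : HasDerivAt e (Complex.I * e θ) θ := by
    have h1 := (Real.hasDerivAt_cos θ).ofReal_comp
    have h2 := ((Real.hasDerivAt_sin θ).ofReal_comp).mul_const Complex.I
    refine (h1.add h2).congr_deriv ?_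
    simp only [he]
    push_cast
    linear_combination (-(Complex.sin θ)) * Complex.I_sq
  have hec : Continuous e := continuous_iff_continuousAt.2 fun θ => (hde θ).continuousAt
  have hnorm (θ : ℝ) : ‖e θ‖ = 1 := by
    have := Complex.norm_exp_ofReal_mul_I θ
    rwa [Complex.exp_mul_I, ← Complex.ofReal_cos, ← Complex.ofReal_sin] at this
  have he0 (θ : ℝ) : e θ ≠ 0 := norm_ne_zero_iff.1 (by rw [hnorm]; norm_num)
  obtain ⟨R, hR0, hR⟩ : ∃ R : ℝ, 0 < R ∧ tsupport f ⊆ ball 0 R :=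
    hc.isCompact.isBounded.subset_ball_lt 0 0
  have hdf : Continuous (fderiv ℝ f) := hf.continuous_fderiv one_ne_zero
  have hd : Differentiable ℝ f := hf.differentiable one_ne_zero
  have hfz (z : ℂ) (hz : R ≤ ‖z‖) : fderiv ℝ f z = 0 := by
    have : z ∉ tsupport f := fun h => absurd (mem_ball_zero_iff.1 (hR h)) (not_lt.2 hz)
    exact Function.notMem_support.1 fun h => this (support_fderiv_subset ℝ h)
  have hfz' (z : ℂ) (hz : R ≤ ‖z‖) : f z = 0 :=
    image_eq_zero_of_notMem_tsupport
      fun h => absurd (mem_ball_zero_iff.1 (hR h)) (not_lt.2 hz)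
  -- The integrand vanishes for `r ≥ R`, so a compact rectangle suffices.
  have hint (c : ℂ) : IntegrableOn
      (fun p : ℝ × ℝ => fderiv ℝ f (p.1 * e p.2) (c * e p.2)) (Ioi 0 ×ˢ Ioo (-Real.pi) Real.pi) := by
    have hcont : Continuous fun p : ℝ × ℝ => fderiv ℝ f (p.1 * e p.2) (c * e p.2) := by
      fun_prop
    have h1 : IntegrableOn (fun p : ℝ × ℝ => fderiv ℝ f (p.1 * e p.2) (c * e p.2))
        (Icc 0 R ×ˢ Icc (-Real.pi) Real.pi) :=
      hcont.continuousOn.integrableOn_compact (isCompact_Icc.prod isCompact_Icc)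
    refine h1.of_forall_sdiff_eq_zero (measurableSet_Ioi.prod measurableSet_Ioo) ?_
    rintro ⟨r, θ⟩ ⟨⟨h2, h3⟩, h4⟩
    have h5 : R ≤ r := by
      by_contra! h
      exact h4 ⟨⟨(mem_Ioi.1 h2).le, h.le⟩, Ioo_subset_Icc_self h3⟩
    simp only
    rw [hfz _ (by rw [norm_mul, hnorm, mul_one, Complex.norm_real]; exact h5.trans (le_abs_self r))]
    rfl
  have hA : ∫ p in Ioi 0 ×ˢ Ioo (-Real.pi) Real.pi, fderiv ℝ f ((p : ℝ × ℝ).1 * e p.2) (1 * e p.2) =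
      -(2 * Real.pi) * f 0 := by
    have h1 (θ : ℝ) : ∫ r in Ioi (0 : ℝ), fderiv ℝ f (r * e θ) (1 * e θ) = -f 0 := by
      have hD (r : ℝ) : HasDerivAt (fun r : ℝ => f (r * e θ)) (fderiv ℝ f (r * e θ) (1 * e θ)) r :=
        (hd _).hasFDerivAt.comp_hasDerivAt r ((Complex.ofRealCLM.hasDerivAt).mul_const (e θ))
      rw [integral_Ioi_of_hasDerivAt_of_tendsto' (m := 0) (fun r _ => hD r) ?_ ?_]
      · simp
      · have hcont : Continuous fun r : ℝ => fderiv ℝ f (r * e θ) (1 * e θ) := by fun_prop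
        refine (hcont.continuousOn.integrableOn_compact
          (isCompact_Icc (a := 0) (b := R))).of_forall_sdiff_eq_zero measurableSet_Ioi ?_
        rintro r ⟨h2, h3⟩
        have h5 : R ≤ r := by
          by_contra! h
          exact h3 ⟨(mem_Ioi.1 h2).le, h.le⟩
        rw [hfz _ (by
          rw [norm_mul, hnorm, mul_one, Complex.norm_real]; exact h5.trans (le_abs_self r))]
        rfl
      · refine tendsto_const_nhds.congr' ?_
        filter_upwards [eventually_ge_atTop R] with r hr
        rw [hfz' _ (by
          rw [norm_mul, hnorm, mul_one, Complex.norm_real]; exact hr.trans (le_abs_self r))]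
    have h2 := hint 1
    rw [Measure.volume_eq_prod] at h2 ⊢
    rw [← setIntegral_prod_swap]
    refine (setIntegral_prod _ h2.swap).trans ?_
    simp only [Function.comp_apply, Prod.swap_prod_mk, h1]
    rw [setIntegral_const, Real.volume_real_Ioo_of_le (by linarith [Real.pi_pos]),
      Complex.real_smul]
    push_cast
    ring
  have hB : ∫ p in Ioi 0 ×ˢ Ioo (-Real.pi) Real.pi,
      fderiv ℝ f ((p : ℝ × ℝ).1 * e p.2) (Complex.I * e p.2) = 0 := by
    have h2 := hint Complex.I
    rw [Measure.volume_eq_prod] at h2 ⊢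
    rw [setIntegral_prod _ h2]
    refine setIntegral_eq_zero_of_forall_eq_zero fun r hr => ?_
    have hr0 : r ≠ 0 := (mem_Ioi.1 hr).ne'
    -- The primitive in `θ` takes the same value at `-π` and `π`.
    have hD (θ : ℝ) : HasDerivAt (fun θ : ℝ => r⁻¹ • f (r * e θ))
        (fderiv ℝ f (r * e θ) (Complex.I * e θ)) θ := by
      have := ((hd _).hasFDerivAt.comp_hasDerivAt θ ((hde θ).const_mul (r : ℂ))).const_smul r⁻¹
      refine this.congr_deriv ?_
      have h3 : (r : ℂ) * (Complex.I * e θ) = r • (Complex.I * e θ) := Complex.real_smul.symm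
      rw [h3, map_smul, smul_smul, inv_mul_cancel₀ hr0, one_smul]
    rw [← integral_Ioc_eq_integral_Ioo,
      ← intervalIntegral.integral_of_le (by linarith [Real.pi_pos]),
      intervalIntegral.integral_eq_sub_of_hasDerivAt (fun θ _ => hD θ)]
    · simp [he]
    · have hcont : Continuous fun θ : ℝ => fderiv ℝ f (r * e θ) (Complex.I * e θ) := by fun_prop
      exact hcont.intervalIntegrable _ _
  rw [← Complex.integral_comp_polarCoord_symm, polarCoord_target]
  have hcongr : ∀ p ∈ Ioi (0 : ℝ) ×ˢ Ioo (-Real.pi) Real.pi,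
      p.1 • (wirtingerBar f (Complex.polarCoord.symm p) / Complex.polarCoord.symm p) =
        (1 / 2 : ℂ) * (fderiv ℝ f (p.1 * e p.2) (1 * e p.2) +
          Complex.I * fderiv ℝ f (p.1 * e p.2) (Complex.I * e p.2)) := by
    rintro ⟨r, θ⟩ ⟨hr, -⟩
    have hr0 : (r : ℂ) ≠ 0 := Complex.ofReal_ne_zero.2 (mem_Ioi.1 hr).ne'
    simp only [Complex.polarCoord_symm_apply]
    change r • (wirtingerBar f (r * e θ) / (r * e θ)) = _
    have h1 : 1 * e θ = Real.cos θ • (1 : ℂ) + Real.sin θ • Complex.I := by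
      simp [he]
    have h2 : Complex.I * e θ = Real.cos θ • Complex.I - Real.sin θ • (1 : ℂ) := by
      simp only [he, Complex.real_smul]
      linear_combination (Real.sin θ : ℂ) * Complex.I_sq
    have h3 : e θ * (Real.cos θ - Real.sin θ * Complex.I) = 1 := by
      simp only [he]
      have : (Real.cos θ : ℂ) ^ 2 + (Real.sin θ : ℂ) ^ 2 = 1 := by
        exact_mod_cast Real.cos_sq_add_sin_sq θ
      linear_combination this - (Real.sin θ : ℂ) ^ 2 * Complex.I_sq
    rw [h1, h2, map_add, map_sub, map_smul, map_smul, map_smul, map_smul, wirtingerBar,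
      Complex.real_smul]
    simp only [Complex.real_smul]
    set a := fderiv ℝ f (r * e θ) 1
    set b := fderiv ℝ f (r * e θ) Complex.I
    rw [mul_div_assoc', mul_div_mul_left _ _ hr0, div_eq_iff (he0 θ)]
    linear_combination (-(a + Complex.I * b) / 2) * h3 -
      (e θ * Real.sin θ * b / 2) * Complex.I_sq
  rw [setIntegral_congr_fun (measurableSet_Ioi.prod measurableSet_Ioo) hcongr,
    integral_const_mul, integral_add (hint 1) ((hint Complex.I).const_mul _), integral_const_mul,
    hA, hB]
  ring

/-! ### The energy inequality for functions decaying like `1 / z` -/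

/-- Fatou's lemma, in the form needed for both limit passages. -/
theorem lintegral_le_of_tendsto {α : Type*} [MeasurableSpace α] {μ : Measure α}
    {G : ℕ → α → ENNReal} {g : α → ENNReal} {b : ℕ → ENNReal} {B : ENNReal}
    (hG : ∀ n, Measurable (G n)) (hg : ∀ᵐ x ∂μ, Tendsto (fun n => G n x) atTop (𝓝 (g x)))
    (hb : ∀ᶠ n in atTop, ∫⁻ x, G n x ∂μ ≤ b n) (hB : Tendsto b atTop (𝓝 B)) :
    ∫⁻ x, g x ∂μ ≤ B := by
  calc ∫⁻ x, g x ∂μ = ∫⁻ x, liminf (fun n => G n x) atTop ∂μ :=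
        lintegral_congr_ae (hg.mono fun x hx => hx.liminf_eq.symm)
    _ ≤ liminf (fun n => ∫⁻ x, G n x ∂μ) atTop := lintegral_liminf_le hG
    _ ≤ liminf b atTop := liminf_le_liminf hb
    _ = B := hB.liminf_eq

/-- Rescaling one fixed bump by `R` divides its gradient by `R`, so `M` bounds the gradient of the
unscaled bump. -/
theorem exists_cutoff : ∃ M : ℝ, 0 ≤ M ∧ ∀ R : ℝ, 0 < R → ∃ χ : ℂ → ℂ, ContDiff ℝ 2 χ ∧
    HasCompactSupport χ ∧ (∀ z, ‖z‖ < R → χ =ᶠ[𝓝 z] fun _ => 1) ∧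
    (∀ z, 2 * R < ‖z‖ → wirtingerBar χ z = 0) ∧ ∀ z, ‖wirtingerBar χ z‖ ≤ M / R := by
  let b : ContDiffBump (0 : ℂ) := ⟨1, 2, one_pos, one_lt_two⟩
  let ψ : ℂ → ℂ := fun z => (b z : ℂ)
  have hψ : ContDiff ℝ 2 ψ := Complex.ofRealCLM.contDiff.comp (b.contDiff (n := 2))
  have hψc : HasCompactSupport ψ := b.hasCompactSupport.comp_left (g := Complex.ofReal) (by simp)
  obtain ⟨M, hM⟩ := (hψ.continuous_fderiv two_ne_zero).bounded_above_of_compact_support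
    (hψc.fderiv ℝ)
  have hM0 : 0 ≤ M := (norm_nonneg _).trans (hM 0)
  refine ⟨M, hM0, fun R hR => ⟨fun z => ψ (R⁻¹ • z), ?_, ?_, ?_, ?_, ?_⟩⟩
  · fun_prop
  · exact hψc.comp_smul (inv_ne_zero hR.ne')
  · intro z hz
    filter_upwards [(isOpen_lt continuous_norm continuous_const).mem_nhds hz] with w hw
    have : b (R⁻¹ • w) = 1 := by
      refine b.one_of_mem_closedBall (mem_closedBall_zero_iff.2 ?_)
      rw [norm_smul, norm_inv, Real.norm_of_nonneg hR.le, inv_mul_le_iff₀ hR]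
      simpa [b] using (show ‖w‖ < R from hw).le
    simp only [ψ, this, Complex.ofReal_one]
  · intro z hz
    have : (fun z => ψ (R⁻¹ • z)) =ᶠ[𝓝 z] fun _ => 0 := by
      filter_upwards [(isOpen_lt continuous_const continuous_norm).mem_nhds hz] with w hw
      have : b (R⁻¹ • w) = 0 := by
        refine b.zero_of_le_dist ?_
        rw [dist_zero_right, norm_smul, norm_inv, Real.norm_of_nonneg hR.le, le_inv_mul_iff₀ hR]
        simpa [b, mul_comm] using (show 2 * R < ‖w‖ from hw).le
      simp only [ψ, this, Complex.ofReal_zero]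
    rw [wirtingerBar_congr this]
    simp [wirtingerBar]
  · intro z
    refine (norm_wirtingerBar_le _ _).trans ?_
    rw [fderiv_comp_smul, norm_smul, norm_inv, Real.norm_of_nonneg hR.le, div_eq_inv_mul]
    gcongr
    exact hM _

/-- Apply the equality for test functions to `χ u`, with `χ` a cutoff at radius `n + 1`. The extra
term `u ∂̄χ` is at most `A M / (n + 1)²` on a disc of area `4π (n + 1)²`, so its energy is
`O(1/n²)`. -/
theorem lintegral_wirtinger_sq_le {u : ℂ → ℂ} (hu : ContDiff ℝ 2 u) {ρ A : ℝ} (hρ : 0 < ρ)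
    (hsupp : ∀ z, ρ ≤ ‖z‖ → wirtingerBar u z = 0) (hA : ∀ z, ρ ≤ ‖z‖ → ‖u z‖ ≤ A / ‖z‖) :
    ∫⁻ z, ‖wirtinger u z‖ₑ ^ 2 ≤ ∫⁻ z, ‖wirtingerBar u z‖ₑ ^ 2 := by
  obtain ⟨M, hM0, hM⟩ := exists_cutoff
  have hA0 : 0 ≤ A := by
    have := (norm_nonneg _).trans (hA (ρ : ℂ) (by simp [abs_of_pos hρ]))
    rwa [Complex.norm_of_nonneg hρ.le, le_div_iff₀ hρ, zero_mul] at this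
  have hn (n : ℕ) : (0 : ℝ) < n + 1 := by positivity
  choose χ hχ hχc hχ1 hχ0 hχM using fun n : ℕ => hM (n + 1) (hn n)
  have hsm (n : ℕ) : ContDiff ℝ 2 (fun z => χ n z * u z) := (hχ n).mul hu
  have hud : Differentiable ℝ u := hu.differentiable two_ne_zero
  have hnear (n : ℕ) (z : ℂ) (hz : ‖z‖ < n + 1) : (fun z => χ n z * u z) =ᶠ[𝓝 z] u := by
    filter_upwards [hχ1 n z hz] with w hw
    rw [hw, one_mul]
  have htop : Tendsto (fun n : ℕ => (n : ℝ) + 1) atTop atTop :=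
    tendsto_atTop_add_const_right _ _ tendsto_natCast_atTop_atTop
  refine lintegral_le_of_tendsto (G := fun n z => ‖wirtinger (fun z => χ n z * u z) z‖ₑ ^ 2)
    (b := fun n => (∫⁻ z, ‖wirtingerBar u z‖ₑ ^ 2) +
      ENNReal.ofReal (4 * A ^ 2 * M ^ 2 * Real.pi * (((n : ℝ) + 1)⁻¹) ^ 2)) ?_ ?_ ?_ ?_
  · intro n
    have := (continuous_wirtinger ((hsm n).of_le (by norm_num))).measurable
    fun_prop
  · refine ae_of_all _ fun z => tendsto_const_nhds.congr' ?_
    filter_upwards [htop.eventually_gt_atTop ‖z‖] with n hz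
    rw [wirtinger_congr (hnear n z hz)]
  · filter_upwards [htop.eventually_ge_atTop ρ] with n hnρ
    rw [lintegral_wirtinger_sq (hsm n) (HasCompactSupport.mul_right (hχc n))]
    -- Since `n + 1 ≥ ρ`, `∂̄u` vanishes wherever `∂̄χ` may not. There is no cross term, and the
    -- constant stays `1`.
    have hpt (z : ℂ) : ‖wirtingerBar (fun z => χ n z * u z) z‖ₑ ^ 2 ≤
        ‖wirtingerBar u z‖ₑ ^ 2 + (closedBall (0 : ℂ) (2 * (n + 1))).indicator
          (fun _ => ENNReal.ofReal ((A * M * (((n : ℝ) + 1)⁻¹) ^ 2) ^ 2)) z := by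
      rcases lt_or_ge ‖z‖ (n + 1) with hz | hz
      · rw [wirtingerBar_congr (hnear n z hz)]
        exact le_self_add
      · have hz0 := hsupp z (hnρ.trans hz)
        rw [wirtingerBar_mul ((hχ n).differentiable two_ne_zero z) (hud z), hz0, mul_zero, zero_add]
        rcases lt_or_ge (2 * ((n : ℝ) + 1)) ‖z‖ with hz2 | hz2
        · simp [hχ0 n z hz2]
        · rw [indicator_of_mem (mem_closedBall_zero_iff.2 hz2),
            ENNReal.ofReal_pow (by positivity)]
          refine le_add_left (pow_le_pow_left' ?_ 2)
          rw [← ofReal_norm, norm_mul]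
          refine ENNReal.ofReal_le_ofReal ?_
          calc ‖u z‖ * ‖wirtingerBar (χ n) z‖ ≤ A / (n + 1) * (M / (n + 1)) := by
                gcongr
                · exact (hA z (hnρ.trans hz)).trans (by gcongr)
                · exact hχM n z
            _ = _ := by ring
    refine (lintegral_mono hpt).trans ?_
    rw [lintegral_add_right _ (measurable_const.indicator measurableSet_closedBall),
      lintegral_indicator_const measurableSet_closedBall, Complex.volume_closedBall]
    refine le_of_eq ?_
    rw [← ENNReal.ofReal_pow (by positivity), ← ENNReal.ofReal_coe_nnreal, ← mul_assoc,
      ← ENNReal.ofReal_mul (by positivity), ← ENNReal.ofReal_mul (by positivity)]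
    congr 2
    have : (n : ℝ) + 1 ≠ 0 := (hn n).ne'
    rw [show ((NNReal.pi : NNReal) : ℝ) = Real.pi from rfl]
    field_simp
    ring
  · have h1 : Tendsto (fun n : ℕ => 4 * A ^ 2 * M ^ 2 * Real.pi * (((n : ℝ) + 1)⁻¹) ^ 2) atTop
        (𝓝 (4 * A ^ 2 * M ^ 2 * Real.pi * 0 ^ 2)) :=
      ((tendsto_inv_atTop_zero.comp htop).pow 2).const_mul _
    have h2 := (ENNReal.tendsto_ofReal h1).const_add (∫⁻ z, ‖wirtingerBar u z‖ₑ ^ 2)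
    simpa using h2

/-! ### The Cauchy transform -/

/-- The Cauchy transform `z ↦ (1/π) ∬ f(ζ) / (ζ - z) dA(ζ)`. -/
noncomputable def cauchyTransform (f : ℂ → ℂ) (z : ℂ) : ℂ :=
  (1 / Real.pi : ℂ) * ∫ ζ, f ζ / (ζ - z)

theorem locallyIntegrable_neg_inv : LocallyIntegrable (fun w : ℂ => -w⁻¹) := by
  refine locallyIntegrable_of_norm_le_rpow (C := 1) (α := 1) ?_ ?_ ?_ ?_
  · simp [Complex.finrank_real_complex]
  · simp [Complex.finrank_real_complex]
  · exact ae_of_all _ fun w => by simp [Real.rpow_neg_one]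
  · exact (measurable_inv.neg).aestronglyMeasurable

/-- As a convolution with a locally integrable kernel, the transform lets derivatives fall on `f`.
-/
theorem cauchyTransform_eq_convolution (f : ℂ → ℂ) (z : ℂ) :
    cauchyTransform f z = (1 / Real.pi : ℂ) *
      convolution (fun w : ℂ => -w⁻¹) f (ContinuousLinearMap.mul ℝ ℂ) volume z := by
  rw [convolution_eq_swap, cauchyTransform]
  congr 2
  ext ζ
  rw [ContinuousLinearMap.mul_apply', ← neg_sub ζ z, inv_neg, neg_neg, div_eq_inv_mul]

theorem integrable_div_sub_of_continuous {f : ℂ → ℂ} (hf : Continuous f)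
    (hc : HasCompactSupport f) (z : ℂ) : Integrable fun ζ => f ζ / (ζ - z) := by
  refine (hc.convolutionExists_right (ContinuousLinearMap.mul ℝ ℂ)
    locallyIntegrable_neg_inv hf z).integrable_swap.congr (ae_of_all _ fun ζ => ?_)
  simp only
  rw [ContinuousLinearMap.mul_apply', ← neg_sub ζ z, inv_neg, neg_neg, div_eq_inv_mul]

theorem contDiff_cauchyTransform {f : ℂ → ℂ} (hf : ContDiff ℝ 2 f) (hc : HasCompactSupport f) :
    ContDiff ℝ 2 (cauchyTransform f) := by
  rw [funext (cauchyTransform_eq_convolution f)]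
  exact contDiff_const.mul (hc.contDiff_convolution_right (n := 2) _ locallyIntegrable_neg_inv hf)

theorem cauchyTransform_wirtingerBar {f : ℂ → ℂ} (hf : ContDiff ℝ 1 f) (hc : HasCompactSupport f)
    (z : ℂ) : cauchyTransform (wirtingerBar f) z = -f z := by
  have hft : ContDiff ℝ 1 (fun w => f (w + z)) := by fun_prop
  have hct : HasCompactSupport (fun w => f (w + z)) :=
    hc.comp_homeomorph (Homeomorph.addRight z)
  have h := integral_wirtingerBar_div hft hct
  have h1 (w : ℂ) : wirtingerBar (fun w => f (w + z)) w = wirtingerBar f (w + z) := by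
    simp only [wirtingerBar, fderiv_comp_add_right]
  simp only [h1, zero_add] at h
  rw [cauchyTransform, ← integral_add_right_eq_self _ z]
  simp only [add_sub_cancel_right, h]
  have : (Real.pi : ℂ) ≠ 0 := Complex.ofReal_ne_zero.2 Real.pi_ne_zero
  field_simp

/-- Differentiation commutes with the convolution, so `∂̄Cf = C∂̄f`, and Cauchy–Pompeiu evaluates
the latter. -/
theorem wirtingerBar_cauchyTransform {f : ℂ → ℂ} (hf : ContDiff ℝ 2 f)
    (hc : HasCompactSupport f) (z : ℂ) : wirtingerBar (cauchyTransform f) z = -f z := by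
  have hf1 : ContDiff ℝ 1 f := hf.of_le (by norm_num)
  rw [← cauchyTransform_wirtingerBar hf1 hc]
  have hfd (v : ℂ) : fderiv ℝ (cauchyTransform f) z v =
      cauchyTransform (fun w => fderiv ℝ f w v) z := by
    have h := (hc.hasFDerivAt_convolution_right (ContinuousLinearMap.mul ℝ ℂ)
      locallyIntegrable_neg_inv hf1 z).const_mul (1 / Real.pi : ℂ)
    rw [funext (cauchyTransform_eq_convolution f), h.fderiv, smul_apply, smul_eq_mul,
      convolution_precompR_apply _ locallyIntegrable_neg_inv (hc.fderiv ℝ)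
        (hf1.continuous_fderiv one_ne_zero), cauchyTransform_eq_convolution]
  have hi (v : ℂ) := integrable_div_sub_of_continuous
    ((hf1.continuous_fderiv one_ne_zero).clm_apply (continuous_const (y := v)))
    (hc.fderiv_apply ℝ v) z
  rw [wirtingerBar, hfd, hfd]
  simp only [cauchyTransform, wirtingerBar]
  rw [mul_left_comm, ← mul_add, mul_div_assoc, ← integral_const_mul,
    ← integral_add (hi 1) ((hi Complex.I).const_mul _), ← integral_div]
  congr 2
  ext ζ
  ring

theorem norm_cauchyTransform_le {f : ℂ → ℂ} {ρ : ℝ} (hρ : 0 < ρ) (hf : Integrable f)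
    (hsupp : ∀ z, ρ ≤ ‖z‖ → f z = 0) {z : ℂ} (hz : 2 * ρ ≤ ‖z‖) :
    ‖cauchyTransform f z‖ ≤ (2 / Real.pi * ∫ ζ, ‖f ζ‖) / ‖z‖ := by
  have hz0 : 0 < ‖z‖ := by linarith
  have h1 : ‖∫ ζ, f ζ / (ζ - z)‖ ≤ ∫ ζ, ‖f ζ‖ * (2 / ‖z‖) := by
    refine norm_integral_le_of_norm_le (hf.norm.mul_const _) (ae_of_all _ fun ζ => ?_)
    rw [norm_div, div_eq_mul_inv]
    rcases lt_or_ge ‖ζ‖ ρ with h | h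
    -- For `‖ζ‖ < ρ ≤ ‖z‖ / 2` one has `‖ζ - z‖ ≥ ‖z‖ / 2`.
    · gcongr
      rw [← inv_div]
      gcongr
      have := norm_sub_norm_le z ζ
      rw [norm_sub_rev] at this
      linarith
    · simp [hsupp ζ h]
  rw [integral_mul_const] at h1
  rw [cauchyTransform, norm_mul, norm_div, norm_one, Complex.norm_of_nonneg Real.pi_pos.le]
  calc _ ≤ 1 / Real.pi * ((∫ ζ, ‖f ζ‖) * (2 / ‖z‖)) := by gcongr
    _ = _ := by ring

theorem lintegral_wirtinger_cauchyTransform_sq_le {f : ℂ → ℂ} (hf : ContDiff ℝ 2 f)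
    (hc : HasCompactSupport f) :
    ∫⁻ z, ‖wirtinger (cauchyTransform f) z‖ₑ ^ 2 ≤ ∫⁻ z, ‖f z‖ₑ ^ 2 := by
  obtain ⟨ρ, hρ0, hρ⟩ : ∃ ρ : ℝ, 0 < ρ ∧ tsupport f ⊆ ball 0 ρ :=
    hc.isCompact.isBounded.subset_ball_lt 0 0
  have hsupp (z : ℂ) (hz : ρ ≤ ‖z‖) : f z = 0 :=
    image_eq_zero_of_notMem_tsupport
      fun h => absurd (mem_ball_zero_iff.1 (hρ h)) (not_lt.2 hz)
  have h := lintegral_wirtinger_sq_le (contDiff_cauchyTransform hf hc)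
    (ρ := 2 * ρ) (by positivity)
    (fun z hz => by rw [wirtingerBar_cauchyTransform hf hc, hsupp z (by linarith), neg_zero])
    (fun z hz => norm_cauchyTransform_le hρ0
      (hf.continuous.integrable_of_hasCompactSupport hc) hsupp hz)
  simpa only [wirtingerBar_cauchyTransform hf hc, enorm_neg] using h

theorem integrable_div_sub_of_eq_zero {f : ℂ → ℂ} (hf : Integrable f) {z : ℂ} {r : ℝ}
    (hr : 0 < r) (h0 : ∀ ζ ∈ ball z r, f ζ = 0) : Integrable fun ζ => f ζ / (ζ - z) := by
  simp only [div_eq_mul_inv]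
  refine (hf.norm.mul_const r⁻¹).mono' (hf.1.mul
    (by fun_prop : Measurable fun ζ : ℂ => (ζ - z)⁻¹).aestronglyMeasurable)
    (ae_of_all _ fun ζ => ?_)
  by_cases hζ : ζ ∈ ball z r
  · simp [h0 ζ hζ]
  · rw [norm_mul, norm_inv]
    gcongr
    rwa [mem_ball, dist_eq_norm, not_lt] at hζ

/-- The Cauchy transform is holomorphic off the support. -/
theorem hasDerivAt_cauchyTransform {f : ℂ → ℂ} (hf : Integrable f) {z : ℂ} {r : ℝ} (hr : 0 < r)
    (h0 : ∀ ζ ∈ ball z r, f ζ = 0) :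
    HasDerivAt (cauchyTransform f) ((1 / Real.pi : ℂ) * ∫ ζ, f ζ / (ζ - z) ^ 2) z := by
  -- Moving the pole by less than `r / 2` keeps it at distance `r / 2` from the support, which gives
  -- a uniform dominating function.
  have hlow {w ζ : ℂ} (hw : w ∈ ball z (r / 2)) (hζ : ζ ∉ ball z r) : r / 2 ≤ ‖ζ - w‖ := by
    rw [mem_ball, not_lt] at hζ
    rw [mem_ball] at hw
    have := dist_triangle ζ w z
    rw [← dist_eq_norm]
    linarith
  have hmeas (w : ℂ) : AEStronglyMeasurable (fun ζ => f ζ / (ζ - w)) := by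
    simp only [div_eq_mul_inv]
    exact hf.1.mul (by fun_prop : Measurable fun ζ : ℂ => (ζ - w)⁻¹).aestronglyMeasurable
  refine HasDerivAt.const_mul _ (hasDerivAt_integral_of_dominated_loc_of_deriv_le
    (F := fun w ζ => f ζ / (ζ - w)) (F' := fun w ζ => f ζ / (ζ - w) ^ 2)
    (bound := fun ζ => ‖f ζ‖ * (r / 2)⁻¹ ^ 2)
    (ball_mem_nhds z (half_pos hr)) (Eventually.of_forall hmeas) ?_ ?_ ?_ ?_ ?_).2
  · exact integrable_div_sub_of_eq_zero hf hr h0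
  · simp only [div_eq_mul_inv]
    exact hf.1.mul (by fun_prop : Measurable fun ζ : ℂ => ((ζ - z) ^ 2)⁻¹).aestronglyMeasurable
  · refine ae_of_all _ fun ζ w hw => ?_
    by_cases hζ : ζ ∈ ball z r
    · simp [h0 ζ hζ]
    · rw [norm_div, div_eq_mul_inv, norm_pow, ← inv_pow]
      gcongr
      exact hlow hw hζ
  · exact hf.norm.mul_const _
  · refine ae_of_all _ fun ζ w hw => ?_
    by_cases hζ : ζ ∈ ball z r
    · simpa [h0 ζ hζ] using hasDerivAt_const w (0 : ℂ)
    · have hne : ζ - w ≠ 0 := norm_pos_iff.1 ((half_pos hr).trans_le (hlow hw hζ))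
      have := (((hasDerivAt_id w).const_sub ζ).inv hne).const_mul (f ζ)
      simp only [div_eq_mul_inv]
      refine this.congr_deriv ?_
      simp

theorem norm_integral_div_sq_le {f : ℂ → ℂ} (hf : Integrable f) {z : ℂ} {r : ℝ} (hr : 0 < r)
    (h0 : ∀ ζ ∈ ball z r, f ζ = 0) :
    ‖(1 / Real.pi : ℂ) * ∫ ζ, f ζ / (ζ - z) ^ 2‖ ≤ 1 / Real.pi * r⁻¹ ^ 2 * ∫ ζ, ‖f ζ‖ := by
  have h1 : ‖∫ ζ, f ζ / (ζ - z) ^ 2‖ ≤ ∫ ζ, r⁻¹ ^ 2 * ‖f ζ‖ := by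
    refine norm_integral_le_of_norm_le (hf.norm.const_mul _) (ae_of_all _ fun ζ => ?_)
    by_cases hζ : ζ ∈ ball z r
    · simp [h0 ζ hζ]
    · rw [norm_div, div_eq_mul_inv, mul_comm, norm_pow, ← inv_pow]
      gcongr
      rwa [mem_ball, dist_eq_norm, not_lt] at hζ
  rw [integral_const_mul] at h1
  rw [norm_mul, norm_div, norm_one, Complex.norm_of_nonneg Real.pi_pos.le, mul_assoc]
  gcongr

/-! ### Approximation by test functions supported in the domain -/

/-- Multiply `f` by smooth cutoffs equal to `1` on the sets of a compact exhaustion of `U`. The norm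
bounds provide domination; the last clause makes the error vanish near each point of `U`. -/
theorem exists_approx {U : Set ℂ} (hU : IsOpen U) {f : ℂ → ℂ}
    (hf : ∀ z ∈ U, ContDiffAt ℝ 2 f z) :
    ∃ F : ℕ → ℂ → ℂ, (∀ n, ContDiff ℝ 2 (F n)) ∧ (∀ n, HasCompactSupport (F n)) ∧
      (∀ n z, ‖F n z‖ ≤ ‖f z‖) ∧ (∀ n z, ‖f z - F n z‖ ≤ ‖f z‖) ∧
      ∀ z ∈ U, ∃ r > 0, ∀ᶠ n in atTop, ∀ ζ ∈ ball z r, F n ζ = f ζ := by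
  have : LocallyCompactSpace U := hU.locallyCompactSpace
  let K := CompactExhaustion.choice U
  have hKc (n : ℕ) : IsCompact (Subtype.val '' K n) := (K.isCompact n).image continuous_subtype_val
  have hKU (n : ℕ) : Subtype.val '' K n ⊆ U := by
    rintro _ ⟨x, -, rfl⟩
    exact x.2
  choose L hLc hKL hLU using fun n => exists_compact_between (hKc n) hU (hKU n)
  choose χ hχ1 hχ0 hχ using fun n => exists_contMDiffMap_one_nhds_of_subset_interior
    (modelWithCornersSelf ℝ ℂ) (n := 2) (hKc n).isClosed (hKL n)
  have hχs (n : ℕ) : ContDiff ℝ 2 (χ n) := (χ n).contMDiff.contDiff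
  have hzero (n : ℕ) (z : ℂ) (hz : z ∉ L n) : (χ n z : ℂ) * f z = 0 := by
    simp [hχ0 n z hz]
  refine ⟨fun n z => (χ n z : ℂ) * f z, fun n => ?_, fun n => ?_, fun n z => ?_, fun n z => ?_,
    fun z hz => ?_⟩
  · refine contDiff_iff_contDiffAt.2 fun z => ?_
    by_cases hz : z ∈ U
    · exact (Complex.ofRealCLM.contDiff.comp (hχs n)).contDiffAt.mul (hf z hz)
    -- Nothing is known about `f` off `U`, but the product vanishes off the compact set `L n ⊆ U`.
    · refine (contDiffAt_const (c := (0 : ℂ))).congr_of_eventuallyEq ?_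
      filter_upwards [(hLc n).isClosed.isOpen_compl.mem_nhds fun h => hz (hLU n h)] with w hw
      exact hzero n w hw
  · exact HasCompactSupport.intro (hLc n) (hzero n)
  · rw [norm_mul, Complex.norm_of_nonneg (hχ n z).1]
    exact mul_le_of_le_one_left (norm_nonneg _) (hχ n z).2
  · rw [← one_sub_mul, norm_mul, ← Complex.ofReal_one, ← Complex.ofReal_sub,
      Complex.norm_of_nonneg (sub_nonneg.2 (hχ n z).2)]
    exact mul_le_of_le_one_left (norm_nonneg _) (by linarith [(hχ n z).1])
  · obtain ⟨N, hN⟩ := K.exists_mem_nhds ⟨z, hz⟩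
    have hN' : Subtype.val '' K N ∈ 𝓝 z := hU.isOpenEmbedding_subtypeVal.image_mem_nhds.2 hN
    obtain ⟨r, hr, hball⟩ := Metric.mem_nhds_iff.1 hN'
    refine ⟨r, hr, (eventually_ge_atTop N).mono fun n hn ζ hζ => ?_⟩
    have h1 : χ n ζ = 1 := (hχ1 n).self_of_nhdsSet ζ (image_mono (K.subset hn) (hball hζ))
    simp [h1]

theorem cauchyTransform_eventuallyEq {f F : ℂ → ℂ} (hf : Integrable f) (hF : ContDiff ℝ 2 F)
    (hc : HasCompactSupport F) {z : ℂ} {r : ℝ} (hr : 0 < r) (h : ∀ ζ ∈ ball z r, F ζ = f ζ) :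
    cauchyTransform f =ᶠ[𝓝 z]
      fun w => cauchyTransform F w + cauchyTransform (fun ζ => f ζ - F ζ) w := by
  filter_upwards [ball_mem_nhds z (half_pos hr)] with w hw
  have hsub : ball w (r / 2) ⊆ ball z r :=
    ball_subset_ball' (by have := mem_ball.1 hw; linarith)
  have h1 := integrable_div_sub_of_continuous hF.continuous hc w
  have h2 := integrable_div_sub_of_eq_zero (f := fun ζ => f ζ - F ζ)
    (hf.sub (hF.continuous.integrable_of_hasCompactSupport hc)) (z := w) (half_pos hr)
    (fun ζ hζ => by rw [h ζ (hsub hζ), sub_self])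
  simp only [cauchyTransform]
  rw [← mul_add, ← integral_add h1 h2]
  congr 2
  ext ζ
  ring

/-- Near `z`, `Cf` is `CF` plus the transform of `f - F`, which is holomorphic there. It contributes
nothing to `∂̄`, and to `∂` only a derivative controlled by the `L¹` norm of `f - F`. -/
theorem cauchyTransform_local {f F : ℂ → ℂ} (hf : Integrable f) (hF : ContDiff ℝ 2 F)
    (hc : HasCompactSupport F) {z : ℂ} {r : ℝ} (hr : 0 < r) (h : ∀ ζ ∈ ball z r, F ζ = f ζ) :
    DifferentiableAt ℝ (cauchyTransform f) z ∧ wirtingerBar (cauchyTransform f) z = -f z ∧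
      ‖wirtinger (cauchyTransform F) z - wirtinger (cauchyTransform f) z‖ ≤
        1 / Real.pi * r⁻¹ ^ 2 * ∫ ζ, ‖f ζ - F ζ‖ := by
  have heq := cauchyTransform_eventuallyEq hf hF hc hr h
  have hi : Integrable fun ζ => f ζ - F ζ :=
    hf.sub (hF.continuous.integrable_of_hasCompactSupport hc)
  have h0 : ∀ ζ ∈ ball z r, f ζ - F ζ = 0 := fun ζ hζ => by rw [h ζ hζ, sub_self]
  have hd1 : DifferentiableAt ℝ (cauchyTransform F) z :=
    (contDiff_cauchyTransform hF hc).differentiable two_ne_zero z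
  have hD := hasDerivAt_cauchyTransform hi hr h0
  have hd2 : DifferentiableAt ℝ (cauchyTransform fun ζ => f ζ - F ζ) z :=
    hD.differentiableAt.restrictScalars ℝ
  refine ⟨(hd1.add hd2).congr_of_eventuallyEq heq, ?_, ?_⟩
  · rw [wirtingerBar_congr heq, wirtingerBar_add hd1 hd2, wirtingerBar_cauchyTransform hF hc,
      wirtingerBar_of_hasDerivAt hD, h z (mem_ball_self hr), add_zero]
  · rw [wirtinger_congr heq, wirtinger_add hd1 hd2, wirtinger_of_hasDerivAt hD, sub_add_cancel_left,
      norm_neg]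
    exact norm_integral_div_sq_le hi hr h0

/-- The condition on `V` keeps it off the boundary of `U`, which may have positive area; pointwise
convergence of `∂C(F n)` is available only away from it. -/
theorem lintegral_wirtinger_cauchyTransform_sq_le_of_isOpen {U V : Set ℂ} (hU : IsOpen U)
    {f : ℂ → ℂ} (hf : ∀ z ∈ U, ContDiffAt ℝ 2 f z) (hf0 : ∀ z ∉ U, f z = 0)
    (hfi : Integrable f) (hVm : MeasurableSet V) (hV : ∀ z ∈ V, z ∈ U ∨ Uᶜ ∈ 𝓝 z) :
    ∫⁻ z in V, ‖wirtinger (cauchyTransform f) z‖ₑ ^ 2 ≤ ∫⁻ z, ‖f z‖ₑ ^ 2 := by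
  obtain ⟨F, hF, hc, hle, hle', hev⟩ := exists_approx hU hf
  have hlim : Tendsto (fun n => ∫ ζ, ‖f ζ - F n ζ‖) atTop (𝓝 0) := by
    have h := tendsto_integral_of_dominated_convergence (μ := (volume : Measure ℂ))
      (F := fun n ζ => ‖f ζ - F n ζ‖) (f := fun _ => (0 : ℝ)) (fun ζ => ‖f ζ‖)
      (fun n => (hfi.1.sub (hF n).continuous.aestronglyMeasurable).norm) hfi.norm
      (fun n => ae_of_all _ fun ζ => by rw [norm_norm]; exact hle' n ζ)
      (ae_of_all _ fun ζ => ?_)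
    · simpa using h
    · refine tendsto_const_nhds.congr' ?_
      by_cases hζ : ζ ∈ U
      · obtain ⟨r, hr, h⟩ := hev ζ hζ
        filter_upwards [h] with n hn
        rw [hn ζ (mem_ball_self hr), sub_self, norm_zero]
      · refine Eventually.of_forall fun n => le_antisymm (norm_nonneg _) ?_
        simpa [hf0 ζ hζ] using hle' n ζ
  have hloc (z : ℂ) (hz : z ∈ V) : ∃ r > 0, ∀ᶠ n in atTop, ∀ ζ ∈ ball z r, F n ζ = f ζ := by
    rcases hV z hz with hz | hz
    · exact hev z hz
    -- Outside `U` the bound `‖F n‖ ≤ ‖f‖` forces `F n = 0 = f`.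
    · obtain ⟨r, hr, hball⟩ := Metric.mem_nhds_iff.1 hz
      refine ⟨r, hr, Eventually.of_forall fun n ζ hζ => ?_⟩
      have h0 := hf0 ζ (hball hζ)
      have := hle n ζ
      rw [h0, norm_zero, norm_le_zero_iff] at this
      rw [this, h0]
  refine lintegral_le_of_tendsto
    (G := fun n z => ‖wirtinger (cauchyTransform (F n)) z‖ₑ ^ 2) (b := fun _ => ∫⁻ z, ‖f z‖ₑ ^ 2)
    (fun n => ?_) ?_ (Eventually.of_forall fun n => ?_) tendsto_const_nhds
  · have := (continuous_wirtinger
      ((contDiff_cauchyTransform (hF n) (hc n)).of_le (by norm_num))).measurable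
    fun_prop
  · refine ae_restrict_of_forall_mem hVm fun z hz => ?_
    obtain ⟨r, hr, h⟩ := hloc z hz
    have h1 : Tendsto (fun n => 1 / Real.pi * r⁻¹ ^ 2 * ∫ ζ, ‖f ζ - F n ζ‖) atTop (𝓝 0) := by
      simpa only [mul_zero] using hlim.const_mul (1 / Real.pi * r⁻¹ ^ 2)
    have h2 : Tendsto (fun n => wirtinger (cauchyTransform (F n)) z) atTop
        (𝓝 (wirtinger (cauchyTransform f) z)) := by
      rw [tendsto_iff_norm_sub_tendsto_zero]
      refine squeeze_zero' (Eventually.of_forall fun n => norm_nonneg _) ?_ h1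
      filter_upwards [h] with n hn
      exact (cauchyTransform_local hfi (hF n) (hc n) hr hn).2.2
    exact (ENNReal.continuous_pow 2).continuousAt.tendsto.comp h2.enorm
  · refine (setLIntegral_le_lintegral _ _).trans
      ((lintegral_wirtinger_cauchyTransform_sq_le (hF n) (hc n)).trans
        (lintegral_mono fun z => ?_))
    gcongr
    exact enorm_le_iff_norm_le.2 (hle n z)

theorem wirtingerBar_cauchyTransform_of_isOpen {U : Set ℂ} (hU : IsOpen U)
    {f : ℂ → ℂ} (hf : ∀ z ∈ U, ContDiffAt ℝ 2 f z) (hfi : Integrable f) {z : ℂ} (hz : z ∈ U) :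
    DifferentiableAt ℝ (cauchyTransform f) z ∧ wirtingerBar (cauchyTransform f) z = -f z := by
  obtain ⟨F, hF, hc, -, -, hev⟩ := exists_approx hU hf
  obtain ⟨r, hr, h⟩ := hev z hz
  obtain ⟨n, hn⟩ := h.exists
  have := cauchyTransform_local hfi (hF n) (hc n) hr hn
  exact ⟨this.1, this.2.1⟩

/-! ### The complementary domains of a Jordan curve -/

theorem IsJordanCurve.isCompact {Γ : Set ℂ} (hΓ : IsJordanCurve Γ) : IsCompact Γ := by
  obtain ⟨c, hc, -, rfl⟩ := hΓ
  exact isCompact_range hc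

theorem inside_subset_compl (Γ : Set ℂ) : inside Γ ⊆ Γᶜ := fun _ hz => hz.1

/-- Components of an open plane set are open, and nearby points share their component, hence its
boundedness. -/
theorem inside_union_eventually {Γ : Set ℂ} (hΓ : IsClosed Γ) {z : ℂ} (hz : z ∉ Γ) :
    ∀ᶠ w in 𝓝 z, w ∉ Γ ∧ (w ∈ inside Γ ↔ z ∈ inside Γ) := by
  filter_upwards [(hΓ.isOpen_compl.connectedComponentIn (x := z)).mem_nhds
    (mem_connectedComponentIn hz)] with w hw
  have hw' : w ∈ Γᶜ := connectedComponentIn_subset _ _ hw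
  refine ⟨hw', ?_⟩
  simp only [inside, mem_ofPred_eq, connectedComponentIn_eq hw, hw', true_and,
    show z ∈ Γᶜ from hz]

theorem isOpen_inside {Γ : Set ℂ} (hΓ : IsClosed Γ) : IsOpen (inside Γ) :=
  isOpen_iff_mem_nhds.2 fun _ hz =>
    (inside_union_eventually hΓ hz.1).mono fun _ hw => hw.2.2 hz

theorem isOpen_outside {Γ : Set ℂ} (hΓ : IsClosed Γ) : IsOpen (Γᶜ \ inside Γ) :=
  isOpen_iff_mem_nhds.2 fun _ hz =>
    (inside_union_eventually hΓ hz.1).mono fun _ hw => ⟨hw.1, fun h => hz.2 (hw.2.1 h)⟩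

/-- The ray `t • z`, `t ≥ 1`, is connected, unbounded and misses `Γ`. -/
theorem mem_outside_of_lt_norm {Γ : Set ℂ} {R : ℝ} (hR : 0 ≤ R) (hΓ : Γ ⊆ closedBall 0 R) {z : ℂ}
    (hz : R < ‖z‖) : z ∈ Γᶜ \ inside Γ := by
  have hz0 : 0 < ‖z‖ := hR.trans_lt hz
  have hsub : (fun t : ℝ => t • z) '' Ici 1 ⊆ Γᶜ := by
    rintro _ ⟨t, ht, rfl⟩ h
    have h1 := mem_closedBall_zero_iff.1 (hΓ h)
    have ht1 : 1 ≤ t := ht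
    rw [norm_smul, Real.norm_of_nonneg (by linarith)] at h1
    nlinarith
  have hmem : z ∈ (fun t : ℝ => t • z) '' Ici 1 := ⟨1, self_mem_Ici, one_smul ℝ z⟩
  refine ⟨hsub hmem, fun h => ?_⟩
  have hpre : IsPreconnected ((fun t : ℝ => t • z) '' Ici 1) :=
    isPreconnected_Ici.image _ (by fun_prop)
  obtain ⟨M, hM⟩ := (h.2.subset
    (hpre.subset_connectedComponentIn hmem hsub)).exists_norm_le
  have hM' := hM _ ⟨max 1 ((M + 1) / ‖z‖), mem_Ici.2 (le_max_left _ _), rfl⟩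
  rw [norm_smul, Real.norm_of_nonneg (le_max_of_le_left zero_le_one)] at hM'
  have h1 : (M + 1) / ‖z‖ * ‖z‖ ≤ max 1 ((M + 1) / ‖z‖) * ‖z‖ := by
    gcongr
    exact le_max_right _ _
  rw [div_mul_cancel₀ _ hz0.ne'] at h1
  linarith

theorem exists_outside {Γ : Set ℂ} (hΓ : IsCompact Γ) :
    ∃ R : ℝ, 0 < R ∧ ∀ z, R ≤ ‖z‖ → z ∈ Γᶜ \ inside Γ := by
  obtain ⟨R, hR0, hR⟩ := hΓ.isBounded.subset_closedBall_lt 0 0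
  exact ⟨R + 1, by linarith, fun z hz => mem_outside_of_lt_norm hR0.le hR (by linarith)⟩

theorem isBounded_inside {Γ : Set ℂ} (hΓ : IsCompact Γ) : Bornology.IsBounded (inside Γ) := by
  obtain ⟨R, -, hR⟩ := exists_outside hΓ
  refine isBounded_closedBall.subset (t := closedBall 0 R) fun z hz => ?_
  rw [mem_closedBall_zero_iff]
  by_contra! h
  exact (hR z h.le).2 hz

theorem coe_mem_OmegaPlus {Γ : Set ℂ} {z : ℂ} : (z : OnePoint ℂ) ∈ OmegaPlus Γ ↔ z ∈ inside Γ :=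
  OnePoint.coe_injective.mem_set_image

theorem infty_notMem_OmegaPlus {Γ : Set ℂ} : ∞ ∉ OmegaPlus Γ := by
  rintro ⟨z, -, hz⟩
  exact OnePoint.coe_ne_infty z hz

theorem coe_mem_OmegaMinus {Γ : Set ℂ} {z : ℂ} :
    (z : OnePoint ℂ) ∈ OmegaMinus Γ ↔ z ∈ Γᶜ \ inside Γ := by
  rw [OmegaMinus, mem_insert_iff, or_iff_right (OnePoint.coe_ne_infty z),
    OnePoint.coe_injective.mem_set_image]
  simp only [inside, Set.mem_sdiff, mem_ofPred_eq, not_and]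
  tauto

theorem infty_mem_OmegaMinus {Γ : Set ℂ} : ∞ ∈ OmegaMinus Γ := mem_insert _ _

/-! ### Holomorphic and harmonic functions on subsets of the sphere -/

theorem IsHolomorphicOn.isHarmonicOn {Ω : Set (OnePoint ℂ)} {f : OnePoint ℂ → ℂ}
    (h : IsHolomorphicOn Ω f) : IsHarmonicOn Ω f :=
  ⟨fun z hz => (h.1 z hz).harmonicAt, fun hi => (h.2 hi).harmonicAt⟩

theorem wirtingerBar_of_analyticAt {f : ℂ → ℂ} {z : ℂ} (h : AnalyticAt ℂ f z) :
    wirtingerBar f z = 0 :=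
  wirtingerBar_of_hasDerivAt h.differentiableAt.hasDerivAt

theorem analyticAt_of_harmonicAt {f : ℂ → ℂ} {z : ℂ} (h : InnerProductSpace.HarmonicAt f z) :
    AnalyticAt ℝ f z := by
  have h1 : AnalyticAt ℝ (fun w => (f w).re) z := HarmonicAt.analyticAt (h.comp_CLM Complex.reCLM)
  have h2 : AnalyticAt ℝ (fun w => (f w).im) z := HarmonicAt.analyticAt (h.comp_CLM Complex.imCLM)
  have h3 := ((Complex.ofRealCLM.analyticAt _).comp h1).add
    (((Complex.ofRealCLM.analyticAt _).comp h2).mul (analyticAt_const (v := Complex.I)))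
  refine h3.congr (Eventually.of_forall fun w => ?_)
  simp [Complex.re_add_im]

theorem contDiffAt_wirtinger {f : ℂ → ℂ} {z : ℂ} (h : AnalyticAt ℝ f z) :
    ContDiffAt ℝ 2 (wirtinger f) z := by
  have h1 : ContDiffAt ℝ 2 (fderiv ℝ f) z :=
    (h.contDiffAt (n := 3)).fderiv_right (by norm_num)
  unfold wirtinger
  fun_prop

theorem contDiffAt_wirtingerBar {f : ℂ → ℂ} {z : ℂ} (h : AnalyticAt ℝ f z) :
    ContDiffAt ℝ 2 (wirtingerBar f) z := by
  have h1 : ContDiffAt ℝ 2 (fderiv ℝ f) z :=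
    (h.contDiffAt (n := 3)).fderiv_right (by norm_num)
  unfold wirtingerBar
  fun_prop

theorem enorm_add_sq_le (x y : ℂ) : ‖x + y‖ₑ ^ 2 ≤ 2 * (‖x‖ₑ ^ 2 + ‖y‖ₑ ^ 2) := by
  have h : ‖x + y‖₊ ^ 2 ≤ 2 * (‖x‖₊ ^ 2 + ‖y‖₊ ^ 2) :=
    (pow_le_pow_left' (nnnorm_add_le x y) 2).trans add_sq_le
  simp only [enorm_eq_nnnorm]
  exact_mod_cast h

/-- Finiteness of the right-hand energy matters: `toReal` sends `⊤` to `0`. -/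
theorem dirichletSeminorm_le {Ω Ω' : Set (OnePoint ℂ)} {f g : OnePoint ℂ → ℂ} {C : NNReal}
    (hg : dirichletEnergy Ω' g < ⊤) (h : dirichletEnergy Ω f ≤ C * dirichletEnergy Ω' g) :
    dirichletSeminorm Ω f ≤ Real.sqrt C * dirichletSeminorm Ω' g := by
  rw [dirichletSeminorm, dirichletSeminorm, ← Real.sqrt_mul C.coe_nonneg]
  refine Real.sqrt_le_sqrt ?_
  have := ENNReal.toReal_mono (ENNReal.mul_ne_top ENNReal.coe_ne_top hg.ne) h
  rwa [ENNReal.toReal_mul, ENNReal.coe_toReal] at this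

/-! ### The jump operator -/

theorem extension_mem {Γ : Set ℂ} {h : Γ → ℂ} (hh : h ∈ HPlus Γ) :
    extension Γ h ∈ DirichletHarm (OmegaPlus Γ) := by
  have hex : ∃ H ∈ DirichletHarm (OmegaPlus Γ), HasBoundaryValues Γ H h := hh
  rw [extension, dif_pos hex]
  exact hex.choose_spec.1

/-- The function `∂̄ h_{Ω⁺}` on `Ω⁺`, extended by zero. -/
noncomputable def density (Γ : Set ℂ) (h : Γ → ℂ) : ℂ → ℂ :=
  (inside Γ).indicator (wirtingerBar fun x : ℂ => extension Γ h x)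

theorem dirichletEnergy_OmegaPlus (Γ : Set ℂ) (f : OnePoint ℂ → ℂ) :
    dirichletEnergy (OmegaPlus Γ) f = ∫⁻ z in inside Γ,
      (‖wirtinger (fun x : ℂ => f x) z‖ₑ ^ 2 + ‖wirtingerBar (fun x : ℂ => f x) z‖ₑ ^ 2) := by
  have : {z : ℂ | (z : OnePoint ℂ) ∈ OmegaPlus Γ} = inside Γ := by
    ext z
    exact coe_mem_OmegaPlus
  rw [dirichletEnergy, this]

theorem dirichletEnergy_OmegaMinus (Γ : Set ℂ) (f : OnePoint ℂ → ℂ) :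
    dirichletEnergy (OmegaMinus Γ) f = ∫⁻ z in Γᶜ \ inside Γ,
      (‖wirtinger (fun x : ℂ => f x) z‖ₑ ^ 2 + ‖wirtingerBar (fun x : ℂ => f x) z‖ₑ ^ 2) := by
  have : {z : ℂ | (z : OnePoint ℂ) ∈ OmegaMinus Γ} = Γᶜ \ inside Γ := by
    ext z
    exact coe_mem_OmegaMinus
  rw [dirichletEnergy, this]

section

variable {Γ : Set ℂ} {h : Γ → ℂ}

theorem analyticAt_extension (hh : h ∈ HPlus Γ) {z : ℂ} (hz : z ∈ inside Γ) :
    AnalyticAt ℝ (fun x : ℂ => extension Γ h x) z :=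
  analyticAt_of_harmonicAt ((extension_mem hh).1.1 z (coe_mem_OmegaPlus.2 hz))

theorem contDiffAt_density (hΓ : IsCompact Γ) (hh : h ∈ HPlus Γ) {z : ℂ} (hz : z ∈ inside Γ) :
    ContDiffAt ℝ 2 (density Γ h) z :=
  (contDiffAt_wirtingerBar (analyticAt_extension hh hz)).congr_of_eventuallyEq
    (eventuallyEq_of_mem ((isOpen_inside hΓ.isClosed).mem_nhds hz) fun _ hw =>
      indicator_of_mem hw _)

theorem density_eq_zero {z : ℂ} (hz : z ∉ inside Γ) : density Γ h z = 0 :=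
  indicator_of_notMem hz _

theorem lintegral_density_sq (hΓ : IsCompact Γ) :
    ∫⁻ z, ‖density Γ h z‖ₑ ^ 2 =
      ∫⁻ z in inside Γ, ‖wirtingerBar (fun x : ℂ => extension Γ h x) z‖ₑ ^ 2 := by
  rw [← lintegral_indicator (isOpen_inside hΓ.isClosed).measurableSet]
  congr 1
  ext z
  by_cases hz : z ∈ inside Γ <;> simp [density, hz]

theorem dirichletEnergy_extension (hΓ : IsCompact Γ) (hh : h ∈ HPlus Γ) :
    dirichletEnergy (OmegaPlus Γ) (extension Γ h) =
      (∫⁻ z in inside Γ, ‖wirtinger (fun x : ℂ => extension Γ h x) z‖ₑ ^ 2) +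
        ∫⁻ z, ‖density Γ h z‖ₑ ^ 2 := by
  have hm := (isOpen_inside hΓ.isClosed).measurableSet
  have h1 : AEMeasurable (wirtinger fun x : ℂ => extension Γ h x)
      (volume.restrict (inside Γ)) :=
    ContinuousOn.aemeasurable (fun z hz => (contDiffAt_wirtinger
      (analyticAt_extension hh hz)).continuousAt.continuousWithinAt) hm
  rw [dirichletEnergy_OmegaPlus, lintegral_add_left' (h1.enorm.pow_const 2),
    lintegral_density_sq hΓ]

/-- Finite energy gives `L²`, and `inside Γ` has finite area, so `L² ⊆ L¹` there. -/
theorem integrable_density (hΓ : IsCompact Γ) (hh : h ∈ HPlus Γ) : Integrable (density Γ h) := by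
  have hm := (isOpen_inside hΓ.isClosed).measurableSet
  have : IsFiniteMeasure (volume.restrict (inside Γ)) :=
    ⟨by simpa using (isBounded_inside hΓ).measure_lt_top⟩
  have h1 : AEStronglyMeasurable (wirtingerBar fun x : ℂ => extension Γ h x)
      (volume.restrict (inside Γ)) :=
    ContinuousOn.aestronglyMeasurable (fun z hz => (contDiffAt_wirtingerBar
      (analyticAt_extension hh hz)).continuousAt.continuousWithinAt) hm
  have h2 := (extension_mem hh).2
  rw [dirichletEnergy_extension hΓ hh, lintegral_density_sq hΓ] at h2
  have h3 : MemLp (wirtingerBar fun x : ℂ => extension Γ h x) 2 (volume.restrict (inside Γ)) := by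
    refine ⟨h1, (eLpNorm_lt_top_iff_lintegral_rpow_enorm_lt_top two_ne_zero
      ENNReal.ofNat_ne_top).2 ?_⟩
    simpa using le_add_self.trans_lt h2
  exact (integrable_indicator_iff hm).2 (h3.integrable one_le_two)

theorem jump_coe (hΓ : IsCompact Γ) (z : ℂ) :
    jump Γ h z = (inside Γ).indicator (fun x : ℂ => extension Γ h x) z +
      cauchyTransform (density Γ h) z := by
  change _ + (1 / Real.pi : ℂ) * _ = _ + (1 / Real.pi : ℂ) * _
  rw [← integral_indicator (isOpen_inside hΓ.isClosed).measurableSet]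
  congr 3
  ext ζ
  by_cases hζ : ζ ∈ inside Γ <;> simp [density, hζ]

theorem jump_eventuallyEq_inside (hΓ : IsCompact Γ) {z : ℂ} (hz : z ∈ inside Γ) :
    (fun x : ℂ => jump Γ h x) =ᶠ[𝓝 z]
      fun x => extension Γ h x + cauchyTransform (density Γ h) x := by
  filter_upwards [(isOpen_inside hΓ.isClosed).mem_nhds hz] with w hw
  rw [jump_coe hΓ, indicator_of_mem hw]

theorem jump_eq_outside (hΓ : IsCompact Γ) {z : ℂ} (hz : z ∉ inside Γ) :
    jump Γ h z = cauchyTransform (density Γ h) z := by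
  rw [jump_coe hΓ, indicator_of_notMem hz, zero_add]

theorem jump_eventuallyEq_outside (hΓ : IsCompact Γ) {z : ℂ} (hz : z ∈ Γᶜ \ inside Γ) :
    (fun x : ℂ => jump Γ h x) =ᶠ[𝓝 z] cauchyTransform (density Γ h) := by
  filter_upwards [(isOpen_outside hΓ.isClosed).mem_nhds hz] with w hw
  exact jump_eq_outside hΓ hw.2

theorem wirtingerBar_cauchyTransform_density (hΓ : IsCompact Γ) (hh : h ∈ HPlus Γ) {z : ℂ}
    (hz : z ∈ inside Γ) : DifferentiableAt ℝ (cauchyTransform (density Γ h)) z ∧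
      wirtingerBar (cauchyTransform (density Γ h)) z = -density Γ h z :=
  wirtingerBar_cauchyTransform_of_isOpen (isOpen_inside hΓ.isClosed)
    (fun _ => contDiffAt_density hΓ hh) (integrable_density hΓ hh) hz

theorem differentiableAt_jump (hΓ : IsCompact Γ) (hh : h ∈ HPlus Γ) {z : ℂ} (hz : z ∉ Γ) :
    DifferentiableAt ℂ (fun x : ℂ => jump Γ h x) z := by
  by_cases hzi : z ∈ inside Γ
  · have h1 := (analyticAt_extension hh hzi).differentiableAt
    obtain ⟨h2, h3⟩ := wirtingerBar_cauchyTransform_density hΓ hh hzi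
    refine DifferentiableAt.congr_of_eventuallyEq ?_ (jump_eventuallyEq_inside hΓ hzi)
    refine differentiableAt_of_wirtingerBar_eq_zero (h1.add h2) ?_
    rw [wirtingerBar_add h1 h2, h3, density, indicator_of_mem hzi, add_neg_cancel]
  · refine DifferentiableAt.congr_of_eventuallyEq ?_ (jump_eventuallyEq_outside hΓ ⟨hz, hzi⟩)
    obtain ⟨r, hr, hball⟩ :=
      Metric.mem_nhds_iff.1 ((isOpen_outside hΓ.isClosed).mem_nhds ⟨hz, hzi⟩)
    exact (hasDerivAt_cauchyTransform (integrable_density hΓ hh) hr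
      fun ζ hζ => density_eq_zero (hball hζ).2).differentiableAt

theorem analyticAt_jump (hΓ : IsCompact Γ) (hh : h ∈ HPlus Γ) {z : ℂ} (hz : z ∉ Γ) :
    AnalyticAt ℂ (fun x : ℂ => jump Γ h x) z :=
  DifferentiableOn.analyticAt (s := Γᶜ)
    (fun _ hw => (differentiableAt_jump hΓ hh hw).differentiableWithinAt)
    (hΓ.isClosed.isOpen_compl.mem_nhds hz)

/-- The bound `‖Cf(1/w)‖ ≤ A ‖w‖` gives continuity at `0` with value `0`, so the singularity is
removable. -/
theorem analyticAt_jump_invChart (hΓ : IsCompact Γ) (hh : h ∈ HPlus Γ) :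
    AnalyticAt ℂ (fun w : ℂ => jump Γ h (invChart w)) 0 := by
  obtain ⟨R, hR0, hR⟩ := exists_outside hΓ
  have hval {w : ℂ} (hw : w ≠ 0) : jump Γ h (invChart w) = jump Γ h ((w⁻¹ : ℂ) : OnePoint ℂ) := by
    rw [invChart, if_neg hw]
  have hval0 : jump Γ h (invChart 0) = 0 := by
    rw [invChart, if_pos rfl]
    rfl
  -- The factor `2` is the margin required by `norm_cauchyTransform_le`.
  have hlarge {w : ℂ} (hw0 : w ≠ 0) (hw : w ∈ ball (0 : ℂ) (2 * R)⁻¹) : 2 * R ≤ ‖w⁻¹‖ := by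
    rw [norm_inv]
    exact (le_inv_comm₀ (norm_pos_iff.2 hw0) (by positivity)).1 (mem_ball_zero_iff.1 hw).le
  have hball : ball (0 : ℂ) (2 * R)⁻¹ ∈ 𝓝 0 := ball_mem_nhds _ (by positivity)
  refine Complex.analyticAt_of_differentiable_on_punctured_nhds_of_continuousAt ?_ ?_
  · filter_upwards [mem_nhdsWithin_of_mem_nhds hball, self_mem_nhdsWithin] with w hw hw0
    have hd := differentiableAt_jump hΓ hh (hR w⁻¹ (by linarith [hlarge hw0 hw])).1
    refine (hd.comp w (differentiableAt_inv hw0)).congr_of_eventuallyEq ?_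
    filter_upwards [isOpen_ne.mem_nhds hw0] with v hv
    exact hval hv
  · rw [ContinuousAt, hval0, tendsto_zero_iff_norm_tendsto_zero]
    set A := 2 / Real.pi * ∫ ζ, ‖density Γ h ζ‖
    have hA : Tendsto (fun w : ℂ => A * ‖w‖) (𝓝 0) (𝓝 0) := by
      have : Continuous fun w : ℂ => A * ‖w‖ := by fun_prop
      simpa using this.tendsto 0
    refine squeeze_zero' (Eventually.of_forall fun w => norm_nonneg _) ?_ hA
    filter_upwards [hball] with w hw
    rcases eq_or_ne w 0 with rfl | hw0
    · simp [hval0]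
    · have h2 := hlarge hw0 hw
      rw [hval hw0, jump_eq_outside hΓ (hR _ (by linarith)).2]
      refine (norm_cauchyTransform_le hR0 (integrable_density hΓ hh)
        (fun z hz => density_eq_zero (hR z hz).2) h2).trans (le_of_eq ?_)
      rw [norm_inv, div_inv_eq_mul]

theorem isHolomorphicOn_projPlus (hΓ : IsCompact Γ) (hh : h ∈ HPlus Γ) :
    IsHolomorphicOn (OmegaPlus Γ) (projPlus Γ h) := by
  refine ⟨fun z hz => ?_, fun hi => absurd hi infty_notMem_OmegaPlus⟩
  rw [coe_mem_OmegaPlus] at hz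
  refine (analyticAt_jump hΓ hh hz.1).congr ?_
  filter_upwards [(isOpen_inside hΓ.isClosed).mem_nhds hz] with w hw
  exact (indicator_of_mem (coe_mem_OmegaPlus.2 hw) _).symm

theorem projMinus_eventuallyEq (hΓ : IsCompact Γ) {z : ℂ} (hz : z ∈ Γᶜ \ inside Γ) :
    (fun x : ℂ => projMinus Γ h x) =ᶠ[𝓝 z] fun x : ℂ => -jump Γ h x := by
  filter_upwards [(isOpen_outside hΓ.isClosed).mem_nhds hz] with w hw
  exact indicator_of_mem (coe_mem_OmegaMinus.2 hw) _

theorem isHolomorphicOn_projMinus (hΓ : IsCompact Γ) (hh : h ∈ HPlus Γ) :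
    IsHolomorphicOn (OmegaMinus Γ) (projMinus Γ h) := by
  refine ⟨fun z hz => ?_, fun _ => ?_⟩
  · rw [coe_mem_OmegaMinus] at hz
    exact (analyticAt_jump hΓ hh hz.1).neg.congr (projMinus_eventuallyEq hΓ hz).symm
  · obtain ⟨R, hR0, hR⟩ := exists_outside hΓ
    refine (analyticAt_jump_invChart hΓ hh).neg.congr ?_
    filter_upwards [ball_mem_nhds (0 : ℂ) (inv_pos.2 hR0)] with w hw
    refine (indicator_of_mem ?_ (-jump Γ h)).symm
    rcases eq_or_ne w 0 with rfl | hw0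
    · rw [invChart, if_pos rfl]
      exact infty_mem_OmegaMinus
    · rw [invChart, if_neg hw0]
      refine coe_mem_OmegaMinus.2 (hR _ ?_)
      rw [norm_inv]
      exact (le_inv_comm₀ (norm_pos_iff.2 hw0) hR0).1 (mem_ball_zero_iff.1 hw).le

theorem lintegral_wirtinger_cauchyTransform_density_sq_le (hΓ : IsCompact Γ) (hh : h ∈ HPlus Γ)
    {V : Set ℂ} (hVm : MeasurableSet V) (hV : V ⊆ Γᶜ) :
    ∫⁻ z in V, ‖wirtinger (cauchyTransform (density Γ h)) z‖ₑ ^ 2 ≤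
      ∫⁻ z, ‖density Γ h z‖ₑ ^ 2 := by
  refine lintegral_wirtinger_cauchyTransform_sq_le_of_isOpen (isOpen_inside hΓ.isClosed)
    (fun _ => contDiffAt_density hΓ hh) (fun _ => density_eq_zero) (integrable_density hΓ hh)
    hVm fun z hz => ?_
  by_cases hzi : z ∈ inside Γ
  · exact Or.inl hzi
  · exact Or.inr (mem_of_superset ((isOpen_outside hΓ.isClosed).mem_nhds ⟨hV hz, hzi⟩)
      fun w hw => hw.2)

/-- By holomorphy only `∂h_{Ω⁺} + ∂Cf` counts; the factor `2` comes from `|a + b|² ≤ 2(|a|² +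
|b|²)`, and the contraction replaces `∂Cf` by `f = ∂̄h_{Ω⁺}`. -/
theorem dirichletEnergy_projPlus_le (hΓ : IsCompact Γ) (hh : h ∈ HPlus Γ) :
    dirichletEnergy (OmegaPlus Γ) (projPlus Γ h) ≤
      (2 : NNReal) * dirichletEnergy (OmegaPlus Γ) (extension Γ h) := by
  have hm := (isOpen_inside hΓ.isClosed).measurableSet
  have h1 : AEMeasurable (wirtinger fun x : ℂ => extension Γ h x)
      (volume.restrict (inside Γ)) :=
    ContinuousOn.aemeasurable (fun z hz => (contDiffAt_wirtinger
      (analyticAt_extension hh hz)).continuousAt.continuousWithinAt) hm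
  rw [dirichletEnergy_extension hΓ hh, dirichletEnergy_OmegaPlus]
  calc _ ≤ ∫⁻ z in inside Γ, 2 * (‖wirtinger (fun x : ℂ => extension Γ h x) z‖ₑ ^ 2 +
          ‖wirtinger (cauchyTransform (density Γ h)) z‖ₑ ^ 2) := by
        refine setLIntegral_mono' hm fun z hz => ?_
        have heq : (fun x : ℂ => projPlus Γ h x) =ᶠ[𝓝 z]
            fun x => extension Γ h x + cauchyTransform (density Γ h) x := by
          filter_upwards [jump_eventuallyEq_inside (h := h) hΓ hz,
            (isOpen_inside hΓ.isClosed).mem_nhds hz] with w hw hwi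
          rw [← hw]
          exact indicator_of_mem (coe_mem_OmegaPlus.2 hwi) _
        rw [wirtingerBar_of_analyticAt
            ((isHolomorphicOn_projPlus hΓ hh).1 z (coe_mem_OmegaPlus.2 hz)),
          wirtinger_congr heq, wirtinger_add (analyticAt_extension hh hz).differentiableAt
            (wirtingerBar_cauchyTransform_density hΓ hh hz).1]
        simpa using enorm_add_sq_le _ _
    _ = 2 * ((∫⁻ z in inside Γ, ‖wirtinger (fun x : ℂ => extension Γ h x) z‖ₑ ^ 2) +
          ∫⁻ z in inside Γ, ‖wirtinger (cauchyTransform (density Γ h)) z‖ₑ ^ 2) := by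
        rw [lintegral_const_mul' _ _ ENNReal.ofNat_ne_top,
          lintegral_add_left' (h1.enorm.pow_const 2)]
    _ ≤ _ := by
        refine mul_le_mul' (by simp) (add_le_add le_rfl ?_)
        exact lintegral_wirtinger_cauchyTransform_density_sq_le hΓ hh hm (inside_subset_compl Γ)

theorem dirichletEnergy_projMinus_le (hΓ : IsCompact Γ) (hh : h ∈ HPlus Γ) :
    dirichletEnergy (OmegaMinus Γ) (projMinus Γ h) ≤
      (1 : NNReal) * dirichletEnergy (OmegaPlus Γ) (extension Γ h) := by
  have hm := (isOpen_outside hΓ.isClosed).measurableSet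
  rw [dirichletEnergy_extension hΓ hh, dirichletEnergy_OmegaMinus, ENNReal.coe_one, one_mul]
  calc _ = ∫⁻ z in Γᶜ \ inside Γ, ‖wirtinger (cauchyTransform (density Γ h)) z‖ₑ ^ 2 := by
        refine setLIntegral_congr_fun hm fun z hz => ?_
        have heq : (fun x : ℂ => projMinus Γ h x) =ᶠ[𝓝 z]
            fun x => -cauchyTransform (density Γ h) x := by
          filter_upwards [projMinus_eventuallyEq (h := h) hΓ hz,
            jump_eventuallyEq_outside (h := h) hΓ hz] with w hw hwi
          rw [hw, hwi]
        rw [wirtingerBar_of_analyticAt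
            ((isHolomorphicOn_projMinus hΓ hh).1 z (coe_mem_OmegaMinus.2 hz)),
          wirtinger_congr heq, wirtinger_neg]
        simp
    _ ≤ _ := (lintegral_wirtinger_cauchyTransform_density_sq_le hΓ hh hm sdiff_subset).trans
        le_add_self

end

end JumpOperator

open JumpOperator in
theorem theorem3p2 (Γ : Set ℂ) (hΓ : IsJordanCurve Γ) :
    (∀ h ∈ HPlus Γ, IsHolomorphicOn (OmegaPlus Γ ∪ OmegaMinus Γ) (jump Γ h)) ∧
    (∃ C : ℝ, ∀ h ∈ HPlus Γ,
      projPlus Γ h ∈ DirichletHol (OmegaPlus Γ) ∧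
      dirichletSeminorm (OmegaPlus Γ) (projPlus Γ h) ≤ C * hPlusSeminorm Γ h) ∧
    (∃ C : ℝ, ∀ h ∈ HPlus Γ,
      projMinus Γ h ∈ DirichletHol (OmegaMinus Γ) ∧
      dirichletSeminorm (OmegaMinus Γ) (projMinus Γ h) ≤ C * hPlusSeminorm Γ h) := by
  have hc := hΓ.isCompact
  -- The constants are the square roots of the energy factors `2` and `1`.
  refine ⟨fun h hh => ⟨fun z hz => analyticAt_jump hc hh ?_,
    fun _ => analyticAt_jump_invChart hc hh⟩, ⟨Real.sqrt (2 : NNReal), fun h hh => ?_⟩,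
    ⟨Real.sqrt (1 : NNReal), fun h hh => ?_⟩⟩
  · rcases hz with hz | hz
    · exact (coe_mem_OmegaPlus.1 hz).1
    · exact (coe_mem_OmegaMinus.1 hz).1
  · have hol := isHolomorphicOn_projPlus hc hh
    have hle := dirichletEnergy_projPlus_le hc hh
    have hfin := (extension_mem hh).2
    exact ⟨⟨⟨hol.isHarmonicOn, hle.trans_lt (ENNReal.mul_lt_top ENNReal.coe_lt_top hfin)⟩, hol⟩,
      dirichletSeminorm_le hfin hle⟩
  · have hol := isHolomorphicOn_projMinus hc hh
    have hle := dirichletEnergy_projMinus_le hc hh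
    have hfin := (extension_mem hh).2
    exact ⟨⟨⟨hol.isHarmonicOn, hle.trans_lt (ENNReal.mul_lt_top ENNReal.coe_lt_top hfin)⟩, hol⟩,
      dirichletSeminorm_le hfin hle⟩
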